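/- Theorem. All polyhedra are abstract polyhedra: ranked posets with vertices, edges and faces (ranks $0,1,2$) in which every edge is incident to exactly two vertices and two faces, any incident vertex and face have exactly two edges incident to both, the incidence graph is connected, and the neighbours of any vertex or face induce a connected subgraph of it. For a flag $\Phi$ (an incident vertex, edge and face), $\Phi^i$ is the unique flag differing from $\Phi$ exactly in its element of rank $i$. A polyhedron is chiral if its automorphism group has exactly two orbits on flags and adjacent flags ($\Phi$ and $\Phi^i$) always lie in different orbits. For a chiral polyhedron $\mathcal P$ with base flag $\Phi$, let $\Gamma^+(\mathcal P)=\langle\sigma_1,\sigma_2\rangle$, where $\sigma_1$ and $\sigma_2$ are the automorphisms sending $\Phi$ to $(\Phi^1)^0$ and to $(\Phi^2)^1$ respectively (products are composed from left to right). $\mathcal P$ has type $\{p,q\}$ if its faces are $p$-gons and its vertices are $q$-valent; it is then tight if it has exactly $2pq$ flags. $\mathcal P$ covers $\mathcal Q$ if, for suitable base flags, there is a homomorphism $\Gamma^+(\mathcal P)\to\Gamma^+(\mathcal Q)$ sending the distinguished generators to the distinguished generators, in order. A chiral polyhedron of type $\{p,q\}$ is atomic if it is tight and covers no tight chiral polyhedron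 of type $\{p',q\}$ with $p'<p$ or of type $\{p,q'\}$ with $q'<q$. Put $$\Gamma^{p,q}(i_1,j_1,i_2,j_2)=\langle \sigma_1,\sigma_2 \mid \sigma_1^p=\sigma_2^q=(\sigma_1\sigma_2)^2=1,\ \sigma_2^{-1}\sigma_1=\sigma_1^{i_1}\sigma_2^{j_1},\ \sigma_2\sigma_1^{-1}=\sigma_1^{i_2}\sigma_2^{j_2}\rangle .$$ Let $\mathcal P$ be an atomic chiral polyhedron of type $\{2^\alpha,2^\beta\}$ with $\beta>\alpha$. Then, for every base flag, one of the following holds, where the equality of groups identifies the distinguished generators of $\Gamma^+(\mathcal P)$ with the generators of the presentation and, in each group, the two signs $\pm$ are equal: (a) $\mathcal P$ is of type $\{8,2^\beta\}$ with $\beta\ge 5$ and $\Gamma^+(\mathcal P)=\Gamma^{8,2^\beta}(3,\,1\pm2^{\beta-2},\,-3,\,-1\pm2^{\beta-2})$; (b) $\mathcal P$ is of type $\{2^\alpha,2^{\alpha+1}\}$ with $\alpha\ge 4$ and $\Gamma^+(\mathcal P)=\Gamma^{2^\alpha,2^{\alpha+1}}(-1+2^{\alpha-1},\,-3\pm2^{\alpha-1},\,1+2^{\alpha-1},\,3\pm2^{\alpha-1})$.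 -/

import Mathlib

namespace TightChiral

universe u

/-- The graph of the incidence relation of a partially ordered set: two distinct elements are joined
when they are comparable. -/
def incidenceGraph (P : Type u) [PartialOrder P] : SimpleGraph P where
  Adj x y := x ≠ y ∧ (x ≤ y ∨ y ≤ x)
  symm := ⟨fun _ _ h => ⟨h.1.symm, h.2.symm⟩⟩
  loopless := ⟨fun _ h => h.1 rfl⟩

/-- An abstract polyhedron: a ranked partially ordered set with elements of rank `0` (vertices),
`1` (edges) and `2` (faces), subject to the usual four axioms. -/
class Polyhedron (P : Type u) extends PartialOrder P where
  /-- the rank function -/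
  rank : P → Fin 3
  rank_strictMono : StrictMono rank
  /-- every edge is incident to exactly two vertices -/
  edge_vertices : ∀ e, rank e = 1 → {v : P | rank v = 0 ∧ v ≤ e}.ncard = 2
  /-- every edge is incident to exactly two faces -/
  edge_faces : ∀ e, rank e = 1 → {f : P | rank f = 2 ∧ e ≤ f}.ncard = 2
  /-- if a vertex and a face are incident, exactly two edges are incident to both -/
  diamond : ∀ v f, rank v = 0 → rank f = 2 → v ≤ f →
    {e : P | rank e = 1 ∧ v ≤ e ∧ e ≤ f}.ncard = 2
  /-- the incidence graph is connected -/
  connected : (incidenceGraph P).Connected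
  /-- the neighbours of a vertex or a face induce a connected graph -/
  link_connected : ∀ x, rank x = 0 ∨ rank x = 2 →
    ((incidenceGraph P).induce ((incidenceGraph P).neighborSet x)).Connected

/-- A flag: a mutually incident vertex, edge and face. -/
structure Flag (P : Type u) [Polyhedron P] where
  /-- the element of rank `i` -/
  elt : Fin 3 → P
  rank_elt : ∀ i, Polyhedron.rank (elt i) = i
  vertex_le_edge : elt 0 ≤ elt 1
  edge_le_face : elt 1 ≤ elt 2

variable {P : Type u} [Polyhedron P]

/-- `Ψ` is the flag `Φ^i`, differing from `Φ` precisely in its element of rank `i`. -/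
def Flag.IsAdj (i : Fin 3) (Φ Ψ : Flag P) : Prop :=
  Φ.elt i ≠ Ψ.elt i ∧ ∀ j, j ≠ i → Φ.elt j = Ψ.elt j

/-- The group of automorphisms (order-preserving bijections with order-preserving inverse).
Automorphisms compose as maps acting on the right: in a product `g * h`, `g` is applied first. -/
abbrev Aut (P : Type u) [Polyhedron P] : Type u := (P ≃o P)ᵐᵒᵖ

/-- The automorphism `g` sends the flag `Φ` to the flag `Ψ`. -/
def Sends (g : Aut P) (Φ Ψ : Flag P) : Prop :=
  ∀ i, g.unop (Φ.elt i) = Ψ.elt i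

/-- Chirality: the flags fall into two (nonempty) classes `C` and `Cᶜ` that are the orbits of the
automorphism group, and adjacent flags lie in different classes. -/
def IsChiral (P : Type u) [Polyhedron P] : Prop :=
  ∃ C : Set (Flag P), C.Nonempty ∧ Cᶜ.Nonempty ∧
    (∀ Φ Ψ : Flag P, (∃ g : Aut P, Sends g Φ Ψ) ↔ (Φ ∈ C ↔ Ψ ∈ C)) ∧
    ∀ (i : Fin 3) (Φ Ψ : Flag P), Φ.IsAdj i Ψ → (Φ ∈ C ↔ Ψ ∉ C)

/-- Schläfli symbol `{p, q}`: all faces are `p`-gons (incident to exactly `p` edges) and all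
vertices are `q`-valent (incident to exactly `q` edges). -/
def HasType (P : Type u) [Polyhedron P] (p q : ℕ) : Prop :=
  (∀ f : P, Polyhedron.rank f = 2 →
    {e : P | Polyhedron.rank e = 1 ∧ e ≤ f}.encard = (p : ℕ∞)) ∧
  (∀ v : P, Polyhedron.rank v = 0 →
    {e : P | Polyhedron.rank e = 1 ∧ v ≤ e}.encard = (q : ℕ∞))

/-- `P` is a tight polyhedron of type `{p, q}`: it has type `{p, q}` and exactly `2pq` flags. -/
def IsTightOfType (P : Type u) [Polyhedron P] (p q : ℕ) : Prop :=
  HasType P p q ∧ ENat.card (Flag P) = ((2 * p * q : ℕ) : ℕ∞)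

/-- `s₁` and `s₂` are the distinguished generators of the rotation group with respect to the base
flag `Φ`: `s₁` sends `Φ` to `(Φ^1)^0` and `s₂` sends `Φ` to `(Φ^2)^1`. -/
def IsRotationPair (Φ : Flag P) (s₁ s₂ : Aut P) : Prop :=
  (∃ Ψ Ω : Flag P, Φ.IsAdj 1 Ψ ∧ Ψ.IsAdj 0 Ω ∧ Sends s₁ Φ Ω) ∧
  (∃ Ψ Ω : Flag P, Φ.IsAdj 2 Ψ ∧ Ψ.IsAdj 1 Ω ∧ Sends s₂ Φ Ω)

/-- The subgroup `⟨s₁, s₂⟩`. -/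
abbrev gen {G : Type*} [Group G] (s₁ s₂ : G) : Subgroup G := Subgroup.closure {s₁, s₂}

/-- `⟨s₁, s₂⟩` covers `⟨t₁, t₂⟩`: there is a homomorphism sending `s₁` to `t₁` and `s₂` to `t₂`. -/
def GroupCovers {G H : Type*} [Group G] [Group H] (s₁ s₂ : G) (t₁ t₂ : H) : Prop :=
  ∃ f : gen s₁ s₂ →* gen t₁ t₂,
    (f ⟨s₁, Subgroup.subset_closure (by simp)⟩ : H) = t₁ ∧
    (f ⟨s₂, Subgroup.subset_closure (by simp)⟩ : H) = t₂

/-- `P` covers `Q`: for suitable base flags the rotation group of `P` covers that of `Q`. -/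
def Covers (P Q : Type u) [Polyhedron P] [Polyhedron Q] : Prop :=
  ∃ (Φ : Flag P) (Ψ : Flag Q) (s₁ s₂ : Aut P) (t₁ t₂ : Aut Q),
    IsRotationPair Φ s₁ s₂ ∧ IsRotationPair Ψ t₁ t₂ ∧ GroupCovers s₁ s₂ t₁ t₂

/-- `P` is an atomic chiral polyhedron of type `{p, q}`: it is chiral and tight of type `{p, q}`,
and covers no tight chiral polyhedron of type `{p', q}` with `p' < p` or `{p, q'}` with `q' < q`. -/
def IsAtomicChiral (P : Type u) [Polyhedron P] (p q : ℕ) : Prop :=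
  IsChiral P ∧ IsTightOfType P p q ∧
  ∀ (Q : Type u) [Polyhedron Q], IsChiral Q → Covers P Q →
    (∀ p' < p, ¬ IsTightOfType Q p' q) ∧ (∀ q' < q, ¬ IsTightOfType Q p q')

/-- The relators of the group `Γ^{p,q}(i₁, j₁, i₂, j₂)`. -/
def relators (p q : ℕ) (i₁ j₁ i₂ j₂ : ℤ) : Set (FreeGroup (Fin 2)) :=
  let x : FreeGroup (Fin 2) := FreeGroup.of 0
  let y : FreeGroup (Fin 2) := FreeGroup.of 1
  {x ^ p, y ^ q, (x * y) ^ 2,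
    y⁻¹ * x * (x ^ i₁ * y ^ j₁)⁻¹,
    y * x⁻¹ * (x ^ i₂ * y ^ j₂)⁻¹}

/-- The group `Γ^{p,q}(i₁, j₁, i₂, j₂)` with generators `σ₁, σ₂` and defining relations
`σ₁^p = σ₂^q = (σ₁σ₂)^2 = 1`, `σ₂⁻¹σ₁ = σ₁^{i₁}σ₂^{j₁}`, `σ₂σ₁⁻¹ = σ₁^{i₂}σ₂^{j₂}`. -/
abbrev GroupGP (p q : ℕ) (i₁ j₁ i₂ j₂ : ℤ) : Type :=
  PresentedGroup (relators p q i₁ j₁ i₂ j₂)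

/-- `⟨s₁, s₂⟩` is the group `Γ^{p,q}(i₁, j₁, i₂, j₂)`, with `s₁, s₂` as the generators
`σ₁, σ₂` of the presentation. -/
def IsGP {G : Type*} [Group G] (s₁ s₂ : G) (p q : ℕ) (i₁ j₁ i₂ j₂ : ℤ) : Prop :=
  ∃ e : GroupGP p q i₁ j₁ i₂ j₂ ≃* gen s₁ s₂,
    (e (PresentedGroup.of 0) : G) = s₁ ∧ (e (PresentedGroup.of 1) : G) = s₂

end TightChiral

namespace TightChiral

/-! ### Groups that are products of two cyclic subgroups -/

section ProductOfCyclic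

variable {G : Type*} [Group G] {x y c : G} {i j : ℤ}

/-! Write x, y for the distinguished generators and G for the group they generate. In a chiral
polyhedron an automorphism is determined by the image of one flag, and Φ never goes to Φ^1. Hence G
is the whole automorphism group, ⟨x⟩ ∩ ⟨y⟩ = 1, and tightness gives |G| = pq, so G = ⟨x⟩⟨y⟩
(`IsChiral.tightPair`). Moreover no endomorphism inverts both x and y (`IsChiral.not_reflexible`).
Conversely, every nonreflexible tight pair comes from a tight chiral polyhedron, built from cosets
(`TightPair.exists_chiral`). Atomicity therefore becomes a statement about groups: dividing by the
involution of ⟨x⟩ or of ⟨y⟩, whenever it generates a normal subgroup, gives a reflexible pair.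

Since α < β, counting shows that the involution c of ⟨y⟩ is central (`TightPair.commute_half`).
Write y⁻¹x = x^i y^j. Reflexibility modulo c gives yx⁻¹ = x^(-i) y^(-j) e with e = 1 or e = c. If e
= 1, these relations are symmetric under inversion and strong enough to make G itself reflexible; so
e = c. The involution d of ⟨x⟩ cannot be central too: reflexibility modulo both ⟨c⟩ and ⟨d⟩, which
meet trivially, would again make G reflexible. Comparing the two relations then yields that j is odd
and x^(i+1) = d (`TightPair.exists_relations`).

Computing conjugates of y² and x⁴ with these relations gives j = 4t + 1 and two congruences modulo
2^β for t (`TightPair.dvd_exponents`). As t and t + 1 are coprime, the power of 2 in t(t + 1) sits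
in one factor; the two possibilities are the two families (`exponents_of_dvd`). Finally the
relations found already define G, because they force every element of the presented group into the
form X^a Y^b (`TightPair.isGP`). -/

theorem mul_comm_inv_of_sq (h : (x * y) ^ 2 = 1) : y * x = x⁻¹ * y⁻¹ := by
  rw [← mul_inv_rev, eq_inv_iff_mul_eq_one]
  have : x * y * (x * y) = 1 := by rw [← sq, h]
  calc y * x * (y * x) = x⁻¹ * (x * y * (x * y)) * x := by group
    _ = 1 := by rw [this]; group

theorem sq_swap (h : (x * y) ^ 2 = 1) : (y * x) ^ 2 = 1 := by
  have := mul_comm_inv_of_sq h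
  rw [sq]; nth_rw 1 [this]; group

theorem zpow_conj_eq (a b : ℤ) (h : x ^ a * y ^ b = c * y ^ b * x ^ a) :
    x ^ a * y ^ b * (x ^ a)⁻¹ = c * y ^ b := by
  rw [h]; group

/-- The two commutation relations between powers that follow from the defining relations. -/
theorem zpow_commutation (h₁ : y⁻¹ * x = x ^ i * y ^ j)
    (h₂ : y * x⁻¹ = x ^ (-i) * y ^ (-j) * c) (hc : Commute c y) :
    x ^ (i + 1) * y ^ j = c⁻¹ * y ^ j * x ^ (i + 1) ∧
      x ^ i * y ^ (j - 1) = c⁻¹ * y ^ (j - 1) * x ^ i := by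
  have h₃ : x * y⁻¹ = c⁻¹ * y ^ j * x ^ i := by
    have := congrArg (·⁻¹) h₂
    simpa [mul_assoc] using this
  constructor
  · calc x ^ (i + 1) * y ^ j = x * (x ^ i * y ^ j) := by group
      _ = x * y⁻¹ * x := by rw [← h₁]; group
      _ = _ := by rw [h₃]; group
  · have hc' : Commute c⁻¹ y⁻¹ := hc.inv_inv
    calc x ^ i * y ^ (j - 1) = (x ^ i * y ^ j) * y⁻¹ := by group
      _ = y⁻¹ * (x * y⁻¹) := by rw [← h₁]; group
      _ = y⁻¹ * c⁻¹ * (y ^ j * x ^ i) := by rw [h₃]; group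
      _ = _ := by rw [← hc'.eq]; group

theorem conj_sq_eq (h₀ : (x * y) ^ 2 = 1) (h₁ : y⁻¹ * x = x ^ i * y ^ j) :
    x * y ^ (-2 : ℤ) * x⁻¹ = x ^ (i + 1) * y ^ (j + 1) := by
  have hx : x = y⁻¹ * x⁻¹ * y⁻¹ := by
    have := mul_comm_inv_of_sq h₀
    calc x = y⁻¹ * (y * x) := by group
      _ = _ := by rw [this]; group
  calc x * y ^ (-2 : ℤ) * x⁻¹ = x * y⁻¹ * (y⁻¹ * x⁻¹ * y⁻¹) * y := by group
    _ = x * (y⁻¹ * x) * y := by rw [← hx]; group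
    _ = _ := by rw [h₁]; group

theorem zpow_mem_of_odd {n : ℕ} {k : ℤ} (hk : Odd k) (hy : y ^ (2 ^ n) = 1) :
    ∃ m : ℤ, y = (y ^ k) ^ m := by
  have : IsCoprime k ((2 : ℤ) ^ n) := by
    apply IsCoprime.pow_right
    obtain ⟨t, rfl⟩ := hk
    exact ⟨1, -t, by ring⟩
  obtain ⟨a, b, hab⟩ := this
  refine ⟨a, ?_⟩
  have h2 : y ^ ((2 : ℤ) ^ n) = 1 := by exact_mod_cast hy
  calc y = y ^ (a * k + b * 2 ^ n) := by rw [hab, zpow_one]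
    _ = _ := by rw [zpow_add, mul_comm b, zpow_mul _ _ b, h2, mul_comm a, zpow_mul]; simp

/-- Conjugation by x sends an even power of y to a power of x times an even power of y, and this
shape survives iteration. Together with yx = x⁻¹y⁻¹, which handles odd powers of y, this lets every
x be moved to the left. -/
theorem exists_eq_zpow_mul_zpow {n : ℕ} (hn : x ^ n = 1) (hn0 : 0 < n) {r k : ℤ}
    (h₀ : (x * y) ^ 2 = 1) (hu : Commute (x ^ r) (y ^ (2 : ℤ)))
    (hconj : x * y ^ (2 : ℤ) * x⁻¹ = x ^ r * y ^ (2 * k)) :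
    ∀ g ∈ gen x y, ∃ a b : ℤ, g = x ^ a * y ^ b := by
  have step : ∀ m : ℤ, x * y ^ (2 * m) * x⁻¹ = x ^ (r * m) * y ^ (2 * (k * m)) := by
    intro m
    have h2 : Commute (x ^ r) (y ^ (2 * k)) := by
      rw [zpow_mul]; exact hu.zpow_right k
    rw [zpow_mul, ← conj_zpow, hconj, h2.mul_zpow, ← zpow_mul, ← zpow_mul, mul_assoc]
  have iter : ∀ (l : ℕ) (m : ℤ), ∃ a b : ℤ,
      x ^ l * y ^ (2 * m) * (x ^ l)⁻¹ = x ^ a * y ^ (2 * b) := by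
    intro l
    induction l with
    | zero => intro m; exact ⟨0, m, by simp⟩
    | succ l ih =>
      intro m
      obtain ⟨a, b, hab⟩ := ih (k * m)
      refine ⟨r * m + a, b, ?_⟩
      calc x ^ (l + 1) * y ^ (2 * m) * (x ^ (l + 1))⁻¹
          = x ^ l * (x * y ^ (2 * m) * x⁻¹) * (x ^ l)⁻¹ := by
            rw [pow_succ]; group
        _ = x ^ (r * m) * (x ^ l * y ^ (2 * (k * m)) * (x ^ l)⁻¹) := by
            rw [step]; group
        _ = _ := by rw [hab, zpow_add, mul_assoc]
  -- Finite order turns conjugation by x⁻¹ into iterated conjugation by x, so `iter` applies to it.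
  have hinv : x⁻¹ = x ^ (n - 1) := by
    rw [inv_eq_iff_mul_eq_one, ← pow_succ', Nat.sub_add_cancel hn0, hn]
  have mulx : ∀ b : ℤ, ∃ a' b' : ℤ, y ^ b * x = x ^ a' * y ^ b' := by
    intro b
    obtain ⟨m, rfl | rfl⟩ := b.even_or_odd'
    · obtain ⟨a, b, hab⟩ := iter (n - 1) m
      rw [← hinv] at hab
      refine ⟨1 + a, 2 * b, ?_⟩
      calc y ^ (2 * m) * x = x * (x⁻¹ * y ^ (2 * m) * x⁻¹⁻¹) := by group
        _ = _ := by rw [hab]; group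
    · refine ⟨-1 + r * m, 2 * (k * m) - 1, ?_⟩
      calc y ^ (2 * m + 1) * x = y ^ (2 * m) * (y * x) := by group
        _ = x⁻¹ * (x * y ^ (2 * m) * x⁻¹) * y⁻¹ := by rw [mul_comm_inv_of_sq h₀]; group
        _ = _ := by rw [step]; group
  have mulpow : ∀ (l : ℕ) (b : ℤ), ∃ a' b' : ℤ, y ^ b * x ^ l = x ^ a' * y ^ b' := by
    intro l
    induction l with
    | zero => intro b; exact ⟨0, b, by simp⟩
    | succ l ih =>
      intro b
      obtain ⟨a, b, hab⟩ := ih b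
      obtain ⟨a', b', hab'⟩ := mulx b
      exact ⟨a + a', b', by rw [pow_succ, ← mul_assoc, hab, mul_assoc, hab', zpow_add, mul_assoc]⟩
  intro g hg
  induction hg using Subgroup.closure_induction_right with
  | one => exact ⟨0, 0, by simp⟩
  | mul_right g _ z hz ih =>
    obtain ⟨a, b, rfl⟩ := ih
    obtain rfl | rfl := hz
    · obtain ⟨a', b', h⟩ := mulx b
      exact ⟨a + a', b', by rw [mul_assoc, h, zpow_add, mul_assoc]⟩
    · exact ⟨a, b + 1, by rw [zpow_add, zpow_one, mul_assoc]⟩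
  | mul_inv_cancel g _ z hz ih =>
    obtain ⟨a, b, rfl⟩ := ih
    obtain rfl | rfl := hz
    · obtain ⟨a', b', h⟩ := mulpow (n - 1) b
      exact ⟨a + a', b', by rw [hinv, mul_assoc, h, zpow_add, mul_assoc]⟩
    · exact ⟨a, b - 1, by rw [zpow_sub, zpow_one, mul_assoc]⟩

/-- The relations defining `GroupGP` force the group to be a product of cyclic subgroups when the
second pair of exponents is, up to an involution, opposite to the first one. -/
theorem exists_eq_zpow_mul_zpow_of_relations {m n : ℕ} (hm0 : 0 < m) (hm : x ^ m = 1)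
    (hn : y ^ (2 ^ n) = 1) (h₀ : (x * y) ^ 2 = 1) (h₁ : y⁻¹ * x = x ^ i * y ^ j)
    (h₂ : y * x⁻¹ = x ^ (-i) * y ^ (-j) * c) (hc : Commute c y) (hc2 : c ^ 2 = 1) (hj : Odd j) :
    ∀ g ∈ gen x y, ∃ a b : ℤ, g = x ^ a * y ^ b := by
  have hcinv : c⁻¹ = c := by rw [inv_eq_iff_mul_eq_one, ← sq, hc2]
  -- x^(i+1) conjugates y^j to c y^j. Squaring removes c, and since j is odd, y is a power of y^j.
  have hu : Commute (x ^ (i + 1)) (y ^ (2 : ℤ)) := by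
    have h := (zpow_commutation h₁ h₂ hc).1
    have hcj : Commute c (y ^ j) := hc.zpow_right j
    have h4 : Commute (x ^ (i + 1)) ((y ^ j) ^ (2 : ℤ)) := by
      rw [hcinv] at h
      have h3 := congrArg (· ^ (2 : ℤ)) (zpow_conj_eq _ _ h)
      simp only [conj_zpow, hcj.mul_zpow] at h3
      rw [show c ^ (2 : ℤ) = 1 by exact_mod_cast hc2, one_mul] at h3
      exact mul_inv_eq_iff_eq_mul.1 h3
    obtain ⟨t, ht⟩ := zpow_mem_of_odd hj hn
    have : y ^ (2 : ℤ) = ((y ^ j) ^ (2 : ℤ)) ^ t := by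
      conv_lhs => rw [ht]
      exact zpow_comm _ _ _
    rw [this]
    exact h4.zpow_right t
  obtain ⟨t, ht⟩ := hj
  have hj1 : j + 1 = 2 * (t + 1) := by rw [ht]; ring
  have hcm : Commute (x ^ (i + 1)) (y ^ (j + 1)) := by
    rw [hj1, zpow_mul]; exact hu.zpow_right _
  have hconj : x * y ^ (2 : ℤ) * x⁻¹ = x ^ (-(i + 1)) * y ^ (2 * (-(t + 1))) := by
    have h := conj_sq_eq h₀ h₁
    have h' := congrArg (·⁻¹) h
    calc x * y ^ (2 : ℤ) * x⁻¹ = (x * y ^ (-2 : ℤ) * x⁻¹)⁻¹ := by group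
      _ = _ := by
        rw [h, hcm.eq, mul_inv_rev, ← zpow_neg, ← zpow_neg, hj1]; congr 2; ring
  refine exists_eq_zpow_mul_zpow (r := -(i + 1)) hm hm0 h₀ ?_ hconj
  rw [zpow_neg]; exact hu.inv_left

end ProductOfCyclic

/-! ### Tight pairs of generators -/

/-- `x` and `y` generate a group with the order properties of the rotation group of a tight
polyhedron of type `{p, q}`. -/
structure TightPair {G : Type*} [Group G] (x y : G) (p q : ℕ) : Prop where
  gen_eq_top : gen x y = ⊤
  orderOf_left : orderOf x = p
  orderOf_right : orderOf y = q
  sq_eq_one : (x * y) ^ 2 = 1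
  disjoint : Disjoint (Subgroup.zpowers x) (Subgroup.zpowers y)
  card_eq : Nat.card G = p * q

/-- Inverting both generators is a group endomorphism. -/
def Reflexible {G : Type*} [Group G] (x y : G) : Prop :=
  ∃ τ : G →* G, τ x = x⁻¹ ∧ τ y = y⁻¹

theorem gen_comm {G : Type*} [Group G] (x y : G) : gen x y = gen y x := by
  unfold gen; rw [Set.pair_comm]

section

variable {G : Type*} [Group G] {x y : G} {p q : ℕ}

theorem TightPair.symm (h : TightPair x y p q) : TightPair y x q p :=
  ⟨by rw [gen_comm]; exact h.1, h.3, h.2, sq_swap h.4, h.5.symm, by rw [h.6, mul_comm]⟩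

theorem TightPair.eq_one_of_zpow_eq (h : TightPair x y p q) {a b : ℤ} (hab : x ^ a = y ^ b) :
    x ^ a = 1 :=
  Subgroup.disjoint_def.1 h.disjoint ⟨a, rfl⟩ (hab ▸ ⟨b, rfl⟩)

theorem TightPair.eq_one_of_zpow_mul_zpow (h : TightPair x y p q) {a b : ℤ}
    (hab : x ^ a * y ^ b = 1) : x ^ a = 1 ∧ y ^ b = 1 := by
  have h1 : x ^ a = y ^ (-b) := by rw [zpow_neg]; exact eq_inv_of_mul_eq_one_left hab
  have h2 := h.eq_one_of_zpow_eq h1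
  exact ⟨h2, by rwa [h2, one_mul] at hab⟩

theorem TightPair.exists_eq (h : TightPair x y p q) (hp : 0 < p) (hq : 0 < q) (g : G) :
    ∃ a b : ℤ, g = x ^ a * y ^ b := by
  have : Finite G := Nat.finite_of_card_ne_zero (by rw [h.card_eq]; positivity)
  have hc := Subgroup.isComplement'_of_card_mul_and_disjoint (by
    rw [Nat.card_zpowers, Nat.card_zpowers, h.card_eq, h.orderOf_left, h.orderOf_right])
    h.disjoint
  obtain ⟨⟨⟨_, a, rfl⟩, ⟨_, b, rfl⟩⟩, hg⟩ := hc.2 g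
  exact ⟨a, b, hg.symm⟩

/-- Quotients by the subgroup of order two of `⟨x⟩`. -/
theorem TightPair.quotient (h : TightPair x y (2 * p) q) (hp : 0 < p)
    (N : Subgroup G) [N.Normal] (hN : N = Subgroup.zpowers (x ^ p)) :
    TightPair (x : G ⧸ N) (y : G ⧸ N) p q := by
  have hNx : N ≤ Subgroup.zpowers x := by
    rw [hN, Subgroup.zpowers_le]; exact Subgroup.npow_mem_zpowers x p
  have hx2 : x ^ (2 * p) = 1 := by rw [← h.orderOf_left, pow_orderOf_eq_one]
  refine ⟨?_, ?_, ?_, ?_, ?_, ?_⟩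
  · have := congrArg (Subgroup.map (QuotientGroup.mk' N)) h.gen_eq_top
    rw [gen, MonoidHom.map_closure, Subgroup.map_top_of_surjective _ (QuotientGroup.mk'_surjective N),
      Set.image_pair] at this
    exact this
  · apply Nat.dvd_antisymm
    · apply orderOf_dvd_of_pow_eq_one
      rw [← QuotientGroup.mk_pow, QuotientGroup.eq_one_iff, hN]
      exact Subgroup.mem_zpowers _
    · have h1 : ((x ^ orderOf (x : G ⧸ N) : G) : G ⧸ N) = 1 := by
        rw [QuotientGroup.mk_pow, pow_orderOf_eq_one]
      replace h1 := hN.le ((QuotientGroup.eq_one_iff _).1 h1)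
      obtain ⟨k, hk⟩ := h1
      have h2 : x ^ (2 * orderOf (x : G ⧸ N)) = 1 := by
        have hk : (x ^ p) ^ k = x ^ orderOf (x : G ⧸ N) := hk
        rw [mul_comm, pow_mul, ← hk, ← zpow_natCast, zpow_comm, zpow_natCast, ← pow_mul,
          mul_comm p, hx2, one_zpow]
      have := orderOf_dvd_of_pow_eq_one h2
      rw [h.orderOf_left] at this
      exact (Nat.mul_dvd_mul_iff_left two_pos).1 this
  · apply Nat.dvd_antisymm
    · apply orderOf_dvd_of_pow_eq_one
      rw [← QuotientGroup.mk_pow, ← h.orderOf_right, pow_orderOf_eq_one, QuotientGroup.mk_one]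
    · have h1 : ((y ^ orderOf (y : G ⧸ N) : G) : G ⧸ N) = 1 := by
        rw [QuotientGroup.mk_pow, pow_orderOf_eq_one]
      rw [QuotientGroup.eq_one_iff] at h1
      have := Subgroup.disjoint_def.1 h.disjoint (hNx h1) (Subgroup.npow_mem_zpowers y _)
      rw [← h.orderOf_right]
      exact orderOf_dvd_of_pow_eq_one this
  · rw [← QuotientGroup.mk_mul, ← QuotientGroup.mk_pow, h.sq_eq_one, QuotientGroup.mk_one]
  · rw [Subgroup.disjoint_def]
    rintro _ ⟨a, rfl⟩ ⟨b, hb⟩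
    have hb : ((y ^ b : G) : G ⧸ N) = ((x ^ a : G) : G ⧸ N) := hb
    have h1 := hNx (QuotientGroup.eq.1 hb.symm)
    have h2 : y ^ b ∈ Subgroup.zpowers x := by
      have := (Subgroup.zpowers x).mul_mem (Subgroup.zpow_mem_zpowers x a) h1
      rwa [mul_inv_cancel_left] at this
    have h3 := Subgroup.disjoint_def.1 h.disjoint h2 (Subgroup.zpow_mem_zpowers y b)
    change ((x ^ a : G) : G ⧸ N) = 1
    rw [← hb, h3, QuotientGroup.mk_one]
  · have h1 := Subgroup.card_eq_card_quotient_mul_card_subgroup N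
    have h2 : Nat.card N = 2 := by
      rw [hN, Nat.card_zpowers, orderOf_pow' _ hp.ne', h.orderOf_left]
      rw [Nat.gcd_mul_left_left]; exact Nat.mul_div_cancel _ hp
    rw [h.card_eq, h2] at h1
    nlinarith

/-- The subgroup of `G × G` that is the graph of the inversion of the generators when the latter
is well defined. -/
abbrev invGraph (x y : G) : Subgroup (G × G) := gen (x, x⁻¹) (y, y⁻¹)

/-- Under the hypothesis the first projection of `invGraph x y` is an isomorphism onto G; its
inverse followed by the second projection is the inverting endomorphism. -/
theorem reflexible_of_invGraph (hgen : gen x y = ⊤)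
    (h : ∀ g : G, (1, g) ∈ invGraph x y → g = 1) : Reflexible x y := by
  let f : invGraph x y →* G := (MonoidHom.fst G G).comp (invGraph x y).subtype
  have hinj : Function.Injective f := by
    rw [injective_iff_map_eq_one]
    rintro ⟨⟨a, b⟩, hab⟩ h1
    obtain rfl : a = 1 := h1
    obtain rfl := h b hab
    rfl
  have hx : (x, x⁻¹) ∈ invGraph x y := Subgroup.subset_closure (by simp)
  have hy : (y, y⁻¹) ∈ invGraph x y := Subgroup.subset_closure (by simp)
  have hsurj : Function.Surjective f := by
    rw [← MonoidHom.range_eq_top, eq_top_iff, ← hgen, Subgroup.closure_le]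
    rintro _ (rfl | rfl)
    · exact ⟨⟨_, hx⟩, rfl⟩
    · exact ⟨⟨_, hy⟩, rfl⟩
  let e : invGraph x y ≃* G := MulEquiv.ofBijective f ⟨hinj, hsurj⟩
  refine ⟨((MonoidHom.snd G G).comp (invGraph x y).subtype).comp e.symm.toMonoidHom, ?_, ?_⟩
  · have : e.symm x = ⟨_, hx⟩ := by rw [MulEquiv.symm_apply_eq]; rfl
    simp [this]
  · have : e.symm y = ⟨_, hy⟩ := by rw [MulEquiv.symm_apply_eq]; rfl
    simp [this]

/-- Modulo N, the subgroup `invGraph x y` lies in the graph of the inverting endomorphism, which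
fixes 1. Applied to two subgroups N with trivial intersection, this proves reflexibility of G. -/
theorem mem_of_mem_invGraph (N : Subgroup G) [N.Normal]
    (h : Reflexible (x : G ⧸ N) (y : G ⧸ N)) {g : G} (hg : (1, g) ∈ invGraph x y) : g ∈ N := by
  obtain ⟨τ, hx, hy⟩ := h
  have key : invGraph x y ≤ MonoidHom.eqLocus
      ((τ.comp (QuotientGroup.mk' N)).comp (MonoidHom.fst G G))
      ((QuotientGroup.mk' N).comp (MonoidHom.snd G G)) := by
    rw [Subgroup.closure_le]
    rintro _ (rfl | rfl)
    · exact hx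
    · exact hy
  have h1 : τ ((1 : G) : G ⧸ N) = (g : G ⧸ N) := key hg
  rw [QuotientGroup.mk_one, map_one] at h1
  exact (QuotientGroup.eq_one_iff g).1 h1.symm

end

/-! ### Generators of two-power order: central involutions and the shape of the relations -/

section TwoPower

variable {G : Type*} [Group G] {x y : G}

theorem half_pow_sq {n : ℕ} (h : orderOf x = 2 ^ n) (hn : 1 ≤ n) : (x ^ 2 ^ (n - 1)) ^ 2 = 1 := by
  rw [← pow_mul, ← pow_succ, Nat.sub_add_cancel hn, ← h, pow_orderOf_eq_one]

theorem half_pow_ne_one {n : ℕ} (h : orderOf x = 2 ^ n) (hn : 1 ≤ n) : x ^ 2 ^ (n - 1) ≠ 1 := by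
  intro h1
  have := orderOf_dvd_of_pow_eq_one h1
  rw [h, Nat.pow_dvd_pow_iff_le_right one_lt_two] at this
  omega

theorem pow_eq_self_of_odd {g : G} {m : ℕ} (hg : g ^ 2 = 1) (hm : Odd m) : g ^ m = g := by
  obtain ⟨k, rfl⟩ := hm
  rw [pow_succ, pow_mul, hg, one_pow, one_mul]

/-- A cyclic 2-group has one subgroup of order two, contained in every nontrivial subgroup: write g
= x^(2^s b) with b odd and s < n, and raise it to the power 2^(n-1-s). -/
theorem exists_pow_eq_half {n : ℕ} (h : orderOf x = 2 ^ n) {g : G}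
    (hg : g ∈ Subgroup.zpowers x) (hg1 : g ≠ 1) : 1 ≤ n ∧ ∃ k : ℕ, g ^ k = x ^ 2 ^ (n - 1) := by
  have hfin : IsOfFinOrder x := orderOf_pos_iff.1 (by rw [h]; positivity)
  obtain ⟨m, rfl⟩ := hfin.mem_powers_iff_mem_zpowers.2 hg
  change x ^ m ≠ 1 at hg1
  have hm0 : m ≠ 0 := by rintro rfl; exact hg1 (pow_zero x)
  obtain ⟨s, b, hb, rfl⟩ := Nat.exists_eq_two_pow_mul_odd hm0
  have hs : s < n := by
    by_contra! hs
    apply hg1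
    rw [← orderOf_dvd_iff_pow_eq_one, h]
    exact (pow_dvd_pow 2 hs).mul_right b
  refine ⟨by omega, 2 ^ (n - 1 - s), ?_⟩
  change (x ^ (2 ^ s * b)) ^ 2 ^ (n - 1 - s) = _
  rw [← pow_mul, mul_right_comm, ← pow_add, Nat.add_sub_of_le (by omega), pow_mul]
  exact pow_eq_self_of_odd (half_pow_sq h (by omega)) hb

theorem eq_half_of_sq_eq_one {n : ℕ} (h : orderOf x = 2 ^ n) {g : G}
    (hg : g ∈ Subgroup.zpowers x) (hg1 : g ≠ 1) (hg2 : g ^ 2 = 1) : g = x ^ 2 ^ (n - 1) := by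
  obtain ⟨hn, k, hk⟩ := exists_pow_eq_half h hg hg1
  rcases k.even_or_odd' with ⟨l, rfl | rfl⟩
  · rw [pow_mul, hg2, one_pow] at hk
    exact absurd hk.symm (half_pow_ne_one h hn)
  · rwa [pow_eq_self_of_odd hg2 ⟨l, rfl⟩] at hk

theorem commute_of_commute_gen (hgen : gen x y = ⊤) {c : G} (hx : Commute c x) (hy : Commute c y)
    (g : G) : Commute c g := by
  have : gen x y ≤ Subgroup.centralizer {c} := by
    rw [Subgroup.closure_le]
    rintro _ (rfl | rfl) <;> simp only [SetLike.mem_coe, Subgroup.mem_centralizer_singleton_iff]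
    exacts [hx.symm, hy.symm]
  rw [hgen] at this
  exact (Subgroup.mem_centralizer_singleton_iff.1 (this (Subgroup.mem_top g))).symm

theorem normal_zpowers_of_central {c : G} (hc : ∀ g, Commute c g) :
    (Subgroup.zpowers c).Normal := by
  constructor
  rintro _ ⟨k, rfl⟩ g
  have : g * c ^ k * g⁻¹ = c ^ k := by
    rw [← ((hc g).zpow_left k).eq, mul_inv_cancel_right]
  exact this ▸ ⟨k, rfl⟩

variable {α β : ℕ}

/-- The product ⟨y⟩ · x⟨y⟩x⁻¹ has too little room in G to be formed without repetition, so ⟨y⟩ meets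
x⟨y⟩x⁻¹ nontrivially. The intersection contains the unique involution of each of these groups, hence
x centralizes the involution of ⟨y⟩. -/
theorem TightPair.commute_half (h : TightPair x y (2 ^ α) (2 ^ β)) (hαβ : α < β) (g : G) :
    Commute (y ^ 2 ^ (β - 1)) g := by
  have hfin : Finite G := Nat.finite_of_card_ne_zero (by rw [h.card_eq]; positivity)
  refine commute_of_commute_gen h.gen_eq_top ?_ ((Commute.refl y).pow_left _) g
  -- Injectivity would give 2^β · 2^β ≤ 2^α · 2^β.
  have hni : ¬ Function.Injective
      (fun a : Subgroup.zpowers y × Subgroup.zpowers y => (a.1 : G) * (x * a.2 * x⁻¹)) := by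
    intro hi
    have := Nat.card_le_card_of_injective _ hi
    rw [Nat.card_prod, h.card_eq, Nat.card_zpowers, h.orderOf_right] at this
    have h2 := Nat.le_of_mul_le_mul_right this (by positivity)
    exact absurd (Nat.pow_lt_pow_right one_lt_two hαβ) (not_lt.2 h2)
  obtain ⟨⟨a, b⟩, ⟨a', b'⟩, hab, hne⟩ : ∃ a b : Subgroup.zpowers y × Subgroup.zpowers y,
      (a.1 : G) * (x * a.2 * x⁻¹) = (b.1 : G) * (x * b.2 * x⁻¹) ∧ a ≠ b := by
    simpa [Function.Injective] using hni
  have hc : x * ((b' * b⁻¹ : Subgroup.zpowers y) : G) * x⁻¹ = ((a'⁻¹ * a : Subgroup.zpowers y) : G) := by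
    simp only at hab
    push_cast
    calc x * (↑b' * (↑b)⁻¹) * x⁻¹ = (a' : G)⁻¹ * (a' * (x * b' * x⁻¹)) * (x * (b : G) * x⁻¹)⁻¹ := by
          group
      _ = _ := by rw [← hab]; group
  have hg1 : ((b' * b⁻¹ : Subgroup.zpowers y) : G) ≠ 1 := by
    intro h1
    rw [h1, mul_one, mul_inv_cancel] at hc
    apply hne
    have e1 : b' = b := mul_inv_eq_one.1 (Subtype.ext h1)
    have e2 : a' = a := inv_mul_eq_one.1 (Subtype.ext hc.symm)
    rw [e1, e2]
  obtain ⟨hβ, k, hk⟩ := exists_pow_eq_half h.orderOf_right (b' * b⁻¹).2 hg1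
  have h3 : x * y ^ 2 ^ (β - 1) * x⁻¹ = y ^ 2 ^ (β - 1) := by
    apply eq_half_of_sq_eq_one h.orderOf_right
    · rw [← hk, ← conj_pow, hc]
      exact Subgroup.pow_mem _ (a'⁻¹ * a).2 k
    · rw [Ne, conj_eq_one_iff]; exact half_pow_ne_one h.orderOf_right hβ
    · rw [conj_pow, half_pow_sq h.orderOf_right hβ, mul_one, mul_inv_cancel]
  exact (mul_inv_eq_iff_eq_mul.1 h3).symm

/-- If x were an involution, conjugation by x would fix x = x⁻¹ and, by (xy)² = 1, invert y. -/
theorem TightPair.sq_ne_one (h : TightPair x y (2 ^ α) (2 ^ β)) (hr : ¬ Reflexible x y) :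
    x ^ 2 ≠ 1 := by
  intro hx
  apply hr
  have hxi : x⁻¹ = x := by rw [inv_eq_iff_mul_eq_one, ← sq]; exact hx
  refine ⟨(MulAut.conj x).toMonoidHom, by rw [hxi]; simp, ?_⟩
  have h1 := h.sq_eq_one
  rw [sq] at h1
  change x * y * x⁻¹ = y⁻¹
  rw [hxi]
  exact eq_inv_of_mul_eq_one_left (by rw [← h1, mul_assoc])

/-- The conditions on the exponents and the relations in the rotation group of a tight chiral
polyhedron of two-power type all of whose minimal quotients are reflexible. -/
theorem TightPair.exists_relations (h : TightPair x y (2 ^ α) (2 ^ β)) (hαβ : α < β)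
    (hr : ¬ Reflexible x y)
    (hx : 1 ≤ α → ∀ (N : Subgroup G) [N.Normal], N = Subgroup.zpowers (x ^ 2 ^ (α - 1)) →
      Reflexible (x : G ⧸ N) (y : G ⧸ N))
    (hy : 1 ≤ β → ∀ (N : Subgroup G) [N.Normal], N = Subgroup.zpowers (y ^ 2 ^ (β - 1)) →
      Reflexible (x : G ⧸ N) (y : G ⧸ N)) :
    2 ≤ α ∧ ∃ i j : ℤ, Odd j ∧ x ^ (i + 1) = x ^ 2 ^ (α - 1) ∧ y⁻¹ * x = x ^ i * y ^ j ∧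
      y * x⁻¹ = x ^ (-i) * y ^ (-j) * y ^ 2 ^ (β - 1) := by
  have hx2 := h.sq_ne_one hr
  have hα : 2 ≤ α := by
    by_contra! hα
    apply hx2
    rw [← orderOf_dvd_iff_pow_eq_one, h.orderOf_left]
    exact (pow_dvd_pow 2 (by omega : α ≤ 1)).trans (by norm_num)
  have hβ : 1 ≤ β := by omega
  refine ⟨hα, ?_⟩
  set c := y ^ 2 ^ (β - 1) with hc
  have hcc : ∀ g, Commute c g := h.commute_half hαβ
  have hc2 : c ^ 2 = 1 := half_pow_sq h.orderOf_right hβ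
  have hc1 : c ≠ 1 := half_pow_ne_one h.orderOf_right hβ
  have : (Subgroup.zpowers c).Normal := normal_zpowers_of_central hcc
  have hrc := hy hβ (Subgroup.zpowers c) rfl
  have hx2n : y ^ 2 ^ β = 1 := by rw [← h.orderOf_right, pow_orderOf_eq_one]
  have hxn : x ^ 2 ^ α = 1 := by rw [← h.orderOf_left, pow_orderOf_eq_one]
  have hcy : Subgroup.zpowers c ≤ Subgroup.zpowers y := by
    rw [Subgroup.zpowers_le]; exact Subgroup.npow_mem_zpowers _ _
  -- A nontrivial g in ⟨x⟩ commuting with y makes the involution of ⟨x⟩ central. Both minimal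
  -- quotients are then reflexible, and their kernels lie in ⟨x⟩ and ⟨y⟩, which meet trivially; so G
  -- would be reflexible.
  have core : ∀ g ∈ Subgroup.zpowers x, Commute g y → g = 1 := by
    intro g hg hgy
    by_contra hg1
    obtain ⟨h1, k, hk⟩ := exists_pow_eq_half h.orderOf_left hg hg1
    have hd : ∀ g', Commute (x ^ 2 ^ (α - 1)) g' := commute_of_commute_gen h.gen_eq_top
      ((Commute.refl x).pow_left _) (hk ▸ hgy.pow_left k)
    have : (Subgroup.zpowers (x ^ 2 ^ (α - 1))).Normal := normal_zpowers_of_central hd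
    have hrd := hx h1 (Subgroup.zpowers (x ^ 2 ^ (α - 1))) rfl
    apply hr
    refine reflexible_of_invGraph h.gen_eq_top fun g hg => ?_
    have m1 := mem_of_mem_invGraph _ hrc hg
    have m2 := mem_of_mem_invGraph _ hrd hg
    refine Subgroup.disjoint_def.1 h.disjoint ?_ (hcy m1)
    exact (Subgroup.zpowers_le.2 (Subgroup.npow_mem_zpowers _ _)) m2
  have sq_one : ∀ (e : G) (a b : ℤ), (∀ g, Commute e g) → e ^ 2 = 1 → Odd b →
      x ^ a * y ^ b = e * y ^ b * x ^ a → (x ^ a) ^ 2 = 1 := by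
    intro e a b he he2 hb hab
    apply core _ (Subgroup.pow_mem _ (Subgroup.zpow_mem_zpowers x a) 2)
    obtain ⟨m, hm⟩ := zpow_mem_of_odd hb hx2n
    have h1 : Commute ((x ^ a) ^ 2) (y ^ b) := by
      rw [sq]
      calc x ^ a * x ^ a * y ^ b = x ^ a * (e * y ^ b * x ^ a) := by rw [← hab]; group
        _ = (x ^ a * e) * y ^ b * x ^ a := by group
        _ = e * (x ^ a * y ^ b) * x ^ a := by rw [← (he _).eq]; group
        _ = e ^ 2 * y ^ b * x ^ a * x ^ a := by rw [hab, sq]; group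
        _ = _ := by rw [he2]; group
    rw [hm]
    exact h1.zpow_right m
  obtain ⟨i, j, hij⟩ := h.exists_eq (by positivity) (by positivity) (y⁻¹ * x)
  -- Applying the inverting endomorphism of G/⟨c⟩ to y⁻¹x = x^i y^j gives the inverted relation up
  -- to an element of ⟨c⟩ = {1, c}.
  obtain ⟨e, he, heq⟩ : ∃ e, (e = 1 ∨ e = c) ∧ y * x⁻¹ = x ^ (-i) * y ^ (-j) * e := by
    refine ⟨(x ^ (-i) * y ^ (-j))⁻¹ * (y * x⁻¹), ?_, by group⟩
    obtain ⟨τ, h1, h2⟩ := hrc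
    have h3 := congrArg τ (congrArg (QuotientGroup.mk' (Subgroup.zpowers c)) hij)
    simp only [map_mul, map_inv, map_zpow, QuotientGroup.mk'_apply, h1, h2, inv_inv] at h3
    simp only [inv_zpow, ← zpow_neg] at h3
    obtain ⟨k, hk⟩ := QuotientGroup.eq.1 (show ((x ^ (-i) * y ^ (-j) : G) : G ⧸ Subgroup.zpowers c) =
      ((y * x⁻¹ : G) : G ⧸ Subgroup.zpowers c) by rw [QuotientGroup.mk_mul, QuotientGroup.mk_mul, QuotientGroup.mk_zpow, QuotientGroup.mk_zpow, QuotientGroup.mk_inv, h3])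
    rw [← hk]
    have hk2 : (c : G) ^ (2 : ℤ) = 1 := by exact_mod_cast hc2
    obtain ⟨l, rfl | rfl⟩ := k.even_or_odd'
    · left; simp [zpow_mul, hk2]
    · right; simp [zpow_add, zpow_mul, hk2]
  have hee : ∀ g, Commute e g := by
    rcases he with rfl | rfl
    exacts [fun g => Commute.one_left g, hcc]
  have he2 : e ^ 2 = 1 := by
    rcases he with rfl | rfl
    exacts [one_pow 2, hc2]
  have hei : e⁻¹ = e := by rw [inv_eq_iff_mul_eq_one, ← sq, he2]
  have hey : e ∈ Subgroup.zpowers y := by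
    rcases he with rfl | rfl
    exacts [Subgroup.one_mem _, hcy (Subgroup.mem_zpowers _)]
  obtain ⟨k₁, k₂⟩ := zpow_commutation hij heq (hee y)
  rw [hei] at k₁ k₂
  -- If j were even, y^(j-1) would generate ⟨y⟩, so (x^i)² = 1 and x^i would conjugate y to y times
  -- a power of e. Rewriting x = y(y⁻¹x) then puts x^(1-i) in ⟨y⟩, so x^(1-i) = 1 and x² = 1, a
  -- contradiction.
  have hj : Odd j := by
    by_contra hj
    have hj' : Odd (j - 1) := (Int.not_odd_iff_even.1 hj).sub_odd odd_one
    have hi2 := sq_one e i (j - 1) hee he2 hj' k₂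
    obtain ⟨m, hm⟩ := zpow_mem_of_odd hj' hx2n
    have k₃ := congrArg (· ^ m) (zpow_conj_eq _ _ k₂)
    simp only [conj_zpow, (hee (y ^ (j - 1))).mul_zpow, ← hm] at k₃
    have k₄ : x = (e ^ m)⁻¹ * x ^ i * y * y ^ j := by
      have : y * x ^ i = (e ^ m)⁻¹ * (x ^ i * y) := by
        rw [mul_inv_eq_iff_eq_mul.1 k₃]; group
      calc x = y * (y⁻¹ * x) := by group
        _ = (y * x ^ i) * y ^ j := by rw [hij]; group
        _ = _ := by rw [this]; group
    have k₅ : x ^ (1 - i) = (e ^ m)⁻¹ * y * y ^ j := by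
      have h1 := ((hee (x ^ (-i))).zpow_left m).inv_left
      have h2 := congrArg (x ^ (-i) * ·) k₄
      calc x ^ (1 - i) = x ^ (-i) * x := by group
        _ = (x ^ (-i) * (e ^ m)⁻¹) * (x ^ i * y * y ^ j) := h2.trans (by simp only [mul_assoc])
        _ = _ := by rw [← h1.eq]; group
    have k₆ : x ^ (1 - i) = 1 := by
      refine Subgroup.disjoint_def.1 h.disjoint ⟨_, rfl⟩ (k₅ ▸ ?_)
      exact mul_mem (mul_mem (inv_mem (Subgroup.zpow_mem _ hey m)) (Subgroup.mem_zpowers y)) ⟨j, rfl⟩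
    apply hx2
    calc x ^ 2 = (x ^ (1 - i)) ^ 2 * (x ^ i) ^ 2 := by group
      _ = 1 := by rw [k₆, hi2]; group
  have hu2 := sq_one e (i + 1) j hee he2 hj k₁
  obtain rfl | rfl := he
  -- Case e = 1: the pairs (x, x⁻¹) and (y, y⁻¹) satisfy the same relations, so an element (1, g) of
  -- `invGraph x y` is (x^a y^b, x^(-a) y^(-b)); then x^a = y^b = 1 and g = 1.
  · exfalso
    apply hr
    refine reflexible_of_invGraph h.gen_eq_top fun g hg => ?_
    have hsq := mul_comm_inv_of_sq h.sq_eq_one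
    obtain ⟨a, b, hab⟩ := exists_eq_zpow_mul_zpow_of_relations (x := (x, x⁻¹)) (y := (y, y⁻¹))
      (i := i) (j := j) (c := 1) (m := 2 ^ α) (n := β) (by positivity)
      (Prod.ext hxn (by simp [hxn])) (Prod.ext hx2n (by simp [hx2n]))
      (Prod.ext h.sq_eq_one (by
        have := congrArg (·⁻¹) (sq_swap h.sq_eq_one)
        simpa [← inv_pow] using this))
      (Prod.ext hij (by simpa using heq)) (Prod.ext (by simpa using heq) (by simpa using hij))
      (Commute.one_left _) (one_pow _) hj _ hg
    obtain ⟨h1, h2⟩ := Prod.ext_iff.1 hab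
    obtain ⟨h3, h4⟩ := h.eq_one_of_zpow_mul_zpow h1.symm
    simpa [h3, h4] using h2
  · refine ⟨i, j, hj, ?_, hij, heq⟩
    apply eq_half_of_sq_eq_one h.orderOf_left ⟨_, rfl⟩ _ hu2
    -- With x^(i+1) = 1 the first commutation relation would read y^j = c y^j.
    intro hu
    rw [show x ^ (i + 1) = 1 from hu, one_mul, mul_one] at k₁
    exact hc1 (right_eq_mul.1 k₁)

end TwoPower

/-! ### Exponents -/

/-- The first divisibility says that t(t + 1) is 2^(β-4) times an odd number, so the even one of t
and t + 1 carries the whole power of 2. The second one then decides α: for t even it forces α = 3,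
for t odd it forces α = β - 1. -/
theorem exponents_of_dvd {α β : ℕ} {t : ℤ} (hα : 3 ≤ α) (hαβ : α < β)
    (h₁ : (2 : ℤ) ^ β ∣ 8 * (t * (t + 1)) + 2 ^ (β - 1))
    (h₂ : (2 : ℤ) ^ β ∣ t * 2 ^ α + 2 ^ (β - 1)) :
    (α = 3 ∧ 5 ≤ β ∧ ∃ n, t = 2 ^ (β - 4) * (2 * n + 1)) ∨
      (β = α + 1 ∧ 4 ≤ α ∧ ∃ n, t + 1 = 2 ^ (β - 4) * (2 * n + 1)) := by
  obtain ⟨s, hs⟩ := (Int.even_mul_succ_self t).two_dvd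
  obtain rfl | hβ : β = 4 ∨ 5 ≤ β := by omega
  -- Since t(t + 1) = 2s, the hypothesis would say that 16 divides 16s + 8.
  · rw [hs] at h₁; norm_num at h₁; omega
  obtain ⟨γ, rfl⟩ := Nat.exists_eq_add_of_le' hβ
  have e1 : γ + 5 - 1 = γ + 4 := rfl
  have e2 : γ + 5 - 4 = γ + 1 := rfl
  rw [e1] at h₁ h₂
  rw [e2]
  obtain ⟨n, hn⟩ : ∃ n, t * (t + 1) = 2 ^ (γ + 1) * (2 * n + 1) := by
    obtain ⟨m, hm⟩ := h₁
    refine ⟨m - 1, ?_⟩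
    have : 8 * (t * (t + 1)) = 8 * (2 ^ (γ + 1) * (2 * (m - 1) + 1)) := by
      ring_nf at hm ⊢; linarith
    linarith
  have key : ∀ a b : ℤ, Odd b → a * b = 2 ^ (γ + 1) * (2 * n + 1) →
      ∃ m, a = 2 ^ (γ + 1) * (2 * m + 1) := by
    intro a b hb hab
    have hcop : IsCoprime ((2 : ℤ) ^ (γ + 1)) b := by
      apply IsCoprime.pow_left
      obtain ⟨l, rfl⟩ := hb
      exact ⟨-l, 1, by ring⟩
    obtain ⟨w, rfl⟩ := hcop.dvd_of_dvd_mul_right ⟨_, hab⟩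
    have hw : w * b = 2 * n + 1 := by
      apply mul_left_cancel₀ (pow_ne_zero (γ + 1) (two_ne_zero (α := ℤ)))
      rw [← hab]; ring
    have : Odd w := (Int.odd_mul.1 (hw ▸ ⟨n, rfl⟩ : Odd (w * b))).1
    obtain ⟨m, rfl⟩ := this
    exact ⟨m, rfl⟩
  rcases Int.even_or_odd t with ht | ht
  · left
    obtain ⟨m, hm⟩ := key t (t + 1) ht.add_one hn
    refine ⟨?_, by omega, m, hm⟩
    -- For α ≥ 4 the term t · 2^α is divisible by 2^β, which leaves 2^β ∣ 2^(β-1).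
    by_contra hne
    obtain ⟨δ, rfl⟩ := Nat.exists_eq_add_of_le' (show 4 ≤ α by omega)
    obtain ⟨l, hl⟩ := h₂
    have : (2 : ℤ) ^ (γ + 4) * 1 = 2 ^ (γ + 4) * (2 * (l - (2 * m + 1) * 2 ^ δ)) := by
      rw [hm] at hl; ring_nf at hl ⊢; linarith
    have := mul_left_cancel₀ (pow_ne_zero (γ + 4) (two_ne_zero (α := ℤ))) this
    omega
  · right
    obtain ⟨m, hm⟩ := key (t + 1) t ht (by rw [← hn]; ring)
    have hdvd : (2 : ℤ) ^ (γ + 4) ∣ 2 ^ α := by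
      have hcop : IsCoprime ((2 : ℤ) ^ (γ + 4)) t := by
        apply IsCoprime.pow_left
        obtain ⟨l, rfl⟩ := ht
        exact ⟨-l, 1, by ring⟩
      apply hcop.dvd_of_dvd_mul_left
      exact (dvd_add_left (dvd_refl _)).1 ((pow_dvd_pow 2 (by omega)).trans h₂)
    have : γ + 4 ≤ α := by
      have h3 : 2 ^ (γ + 4) ∣ 2 ^ α := by exact_mod_cast hdvd
      exact (Nat.pow_dvd_pow_iff_le_right one_lt_two).1 h3
    exact ⟨by omega, by omega, m, hm⟩

/-! ### Congruences for the exponents, and the presentation -/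

section TwoPower

variable {G : Type*} [Group G] {x y : G} {α β : ℕ}

theorem zpow_eq_zpow_of_dvd {q : ℕ} {a b : ℤ} (h : x ^ q = 1) (hab : (q : ℤ) ∣ a - b) :
    x ^ a = x ^ b := by
  obtain ⟨k, hk⟩ := hab
  rw [show a = q * k + b by linarith, zpow_add, zpow_mul, zpow_natCast, h, one_zpow, one_mul]

/-- Here x^(i+1) = d is the involution of ⟨x⟩ and c that of ⟨y⟩. Each congruence arises from
evaluating one conjugate in two ways and comparing powers of y: the first from a power of x y⁻² x⁻¹,
the second from y⁻¹ d y. -/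
theorem TightPair.dvd_exponents (h : TightPair x y (2 ^ α) (2 ^ β)) (hαβ : α < β) (hα : 2 ≤ α)
    {i j : ℤ} (hj : Odd j) (hd : x ^ (i + 1) = x ^ 2 ^ (α - 1)) (hij : y⁻¹ * x = x ^ i * y ^ j)
    (heq : y * x⁻¹ = x ^ (-i) * y ^ (-j) * y ^ 2 ^ (β - 1)) :
    3 ≤ α ∧ ∃ t : ℤ, j = 4 * t + 1 ∧ (2 : ℤ) ^ β ∣ 8 * (t * (t + 1)) + 2 ^ (β - 1) ∧
      (2 : ℤ) ^ β ∣ t * 2 ^ α + 2 ^ (β - 1) := by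
  have hβ : 1 ≤ β := by omega
  have hq : y ^ 2 ^ β = 1 := by rw [← h.orderOf_right, pow_orderOf_eq_one]
  have hcz : y ^ 2 ^ (β - 1) = y ^ ((2 : ℤ) ^ (β - 1)) := by
    rw [← zpow_natCast]; push_cast; rfl
  have hdvd : ∀ a : ℤ, y ^ a = 1 → (2 : ℤ) ^ β ∣ a := by
    intro a ha
    have := orderOf_dvd_iff_zpow_eq_one.2 ha
    rw [h.orderOf_right] at this
    exact_mod_cast this
  have hcc : ∀ g, Commute (y ^ 2 ^ (β - 1)) g := h.commute_half hαβ
  have hc2 : (y ^ 2 ^ (β - 1)) ^ 2 = 1 := half_pow_sq h.orderOf_right hβ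
  have hd2 : (x ^ 2 ^ (α - 1)) ^ 2 = 1 := half_pow_sq h.orderOf_left (by omega)
  have hd1 : x ^ 2 ^ (α - 1) ≠ 1 := half_pow_ne_one h.orderOf_left (by omega)
  have hdx : Commute (x ^ 2 ^ (α - 1)) x := (Commute.refl x).pow_left _
  obtain ⟨k₁, k₂⟩ := zpow_commutation hij heq (hcc y)
  have hconj := conj_sq_eq h.sq_eq_one hij
  set c := y ^ 2 ^ (β - 1) with hc
  have hci : c⁻¹ = c := by rw [inv_eq_iff_mul_eq_one, ← sq, hc2]
  rw [hci] at k₁ k₂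
  rw [hd] at k₁ hconj
  have hxi : x ^ i = x ^ 2 ^ (α - 1) * x⁻¹ := by
    rw [← hd]; group
  set d := x ^ 2 ^ (α - 1) with hdd
  have hdi : d⁻¹ = d := by rw [inv_eq_iff_mul_eq_one, ← sq, hd2]
  have hdmem : ∀ a : ℤ, d ^ a ∈ Subgroup.zpowers x := fun a =>
    Subgroup.zpow_mem _ (Subgroup.npow_mem_zpowers _ _) a
  have hdy2 : Commute d (y ^ (2 : ℤ)) := by
    have h1 : Commute d ((y ^ j) ^ (2 : ℤ)) := by
      have h3 : d * y ^ j * d⁻¹ = c * y ^ j := by rw [k₁]; group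
      have h4 := congrArg (· ^ (2 : ℤ)) h3
      simp only [conj_zpow, (hcc (y ^ j)).mul_zpow] at h4
      rw [show c ^ (2 : ℤ) = 1 by exact_mod_cast hc2, one_mul] at h4
      exact mul_inv_eq_iff_eq_mul.1 h4
    obtain ⟨m, hm⟩ := zpow_mem_of_odd hj hq
    rw [show y ^ (2 : ℤ) = ((y ^ j) ^ (2 : ℤ)) ^ m by
      conv_lhs => rw [hm]
      exact zpow_comm _ _ _]
    exact h1.zpow_right m
  have hdev : ∀ a : ℤ, Commute d (y ^ (2 * a)) := fun a => by
    rw [zpow_mul]; exact hdy2.zpow_right a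
  obtain ⟨k, rfl⟩ := hj
  rw [show 2 * k + 1 - 1 = 2 * k by ring] at k₂
  have hdy : d * y = c * y * d := by
    calc d * y = d * y ^ (2 * k + 1) * y ^ (2 * (-k)) := by group
      _ = c * y ^ (2 * k + 1) * (d * y ^ (2 * (-k))) := by rw [k₁]; group
      _ = _ := by rw [(hdev (-k)).eq]; group
  have hydy : y⁻¹ * d * y = c * d := by
    rw [mul_assoc, hdy, (hcc y).eq]; group
  have hxk : x * y ^ (2 * k) = c * y ^ (2 * k) * x := by
    rw [hxi] at k₂
    have h1 : x⁻¹ * y ^ (2 * k) = c * y ^ (2 * k) * x⁻¹ := by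
      have e1 : d * x⁻¹ = x⁻¹ * d := hdx.inv_right.eq
      rw [e1] at k₂
      have e2 : x⁻¹ * y ^ (2 * k) * d = c * y ^ (2 * k) * x⁻¹ * d := by
        rw [mul_assoc x⁻¹, ← (hdev k).eq, ← mul_assoc, k₂, mul_assoc]
        group
      exact mul_right_cancel e2
    calc x * y ^ (2 * k) = x * (y ^ (2 * k) * x⁻¹) * x := by group
      _ = x * (c⁻¹ * (c * y ^ (2 * k) * x⁻¹)) * x := by group
      _ = x * (c * x⁻¹) * y ^ (2 * k) * x := by rw [← h1, hci]; group
      _ = _ := by rw [(hcc x⁻¹).eq]; group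
  -- With j = 2k + 1, the power -k of x y⁻² x⁻¹ is x y^(2k) x⁻¹, which is also c y^(2k). Comparison
  -- gives d^k = 1, so k = 2t, and the first congruence.
  have hsq : (x * y ^ (-2 : ℤ) * x⁻¹) ^ (-k) = d ^ (-k) * y ^ ((2 * k + 1 + 1) * (-k)) := by
    rw [hconj, show 2 * k + 1 + 1 = 2 * (k + 1) by ring, (hdev (k + 1)).mul_zpow, ← zpow_mul]
  have hk1 : d ^ (-k) * y ^ ((2 * k + 1 + 1) * (-k)) = c * y ^ (2 * k) := by
    rw [← hsq, conj_zpow, ← zpow_mul, show (-2 : ℤ) * -k = 2 * k by ring, hxk,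
      mul_inv_cancel_right]
  have hk2 : d ^ (-k) = y ^ (2 * k + (2 * k + 1 + 1) * k + 2 ^ (β - 1)) := by
    rw [eq_mul_inv_of_mul_eq hk1, hcz]
    simp only [← zpow_neg, ← zpow_add]; congr 1; ring
  have hk3 : d ^ (-k) = 1 :=
    Subgroup.disjoint_def.1 h.disjoint (hdmem _) (hk2 ▸ Subgroup.zpow_mem_zpowers _ _)
  have hkd := hdvd _ (hk2.symm.trans hk3)
  have hd2z : d ^ (2 : ℤ) = 1 := by exact_mod_cast hd2
  obtain ⟨t, rfl | rfl⟩ := k.even_or_odd'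
  swap
  · exfalso
    apply hd1
    rw [zpow_neg, zpow_add, zpow_mul, hd2z, one_zpow, one_mul, zpow_one, hdi] at hk3
    exact hk3
  set k := 2 * t with hkt
  have hyx : y⁻¹ * x ^ (2 : ℤ) * y = x ^ (i - 1) * (c * y ^ (2 * k)) := by
    have e1 : y⁻¹ = x * y * x := by
      rw [mul_assoc, mul_comm_inv_of_sq h.sq_eq_one]; group
    calc y⁻¹ * x ^ (2 : ℤ) * y = y⁻¹ * x * (x * y * x) * x⁻¹ := by rw [zpow_two]; group
      _ = (y⁻¹ * x) * y⁻¹ * x⁻¹ := by rw [← e1]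
      _ = x ^ (i - 1) * (x * y ^ (2 * k)) * x⁻¹ := by rw [hij]; group
      _ = _ := by rw [hxk]; group
  have hi1 : x ^ (i - 1) = d * x ^ (-2 : ℤ) := by
    rw [← hd]; group
  -- For α = 2 one has d = x², and the formula for y⁻¹x²y would put d into ⟨y⟩.
  have hα3 : 3 ≤ α := by
    by_contra! hα3
    obtain rfl : α = 2 := by omega
    have hdx2 : d = x ^ (2 : ℤ) := by rw [hdd]; norm_cast
    apply hd1
    have e1 : x ^ (i - 1) = 1 := by rw [hi1, hdx2]; group
    rw [← hdx2, hydy, e1, one_mul] at hyx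
    have e2 := mul_left_cancel hyx
    exact Subgroup.disjoint_def.1 h.disjoint (Subgroup.npow_mem_zpowers _ _)
      (e2 ▸ Subgroup.zpow_mem_zpowers _ _)
  have hcom : Commute (x ^ (2 : ℤ)) (y ^ (2 * k)) := by
    change x ^ (2 : ℤ) * y ^ (2 * k) = y ^ (2 * k) * x ^ (2 : ℤ)
    calc x ^ (2 : ℤ) * y ^ (2 * k) = x * (x * y ^ (2 * k)) := by rw [zpow_two]; group
      _ = (x * c) * y ^ (2 * k) * x := by rw [hxk]; group
      _ = c * (x * y ^ (2 * k)) * x := by rw [← (hcc x).eq]; group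
      _ = (c * c) * y ^ (2 * k) * x * x := by rw [hxk]; group
      _ = _ := by rw [← sq, hc2, zpow_two]; group
  have hcom' : Commute (x ^ (-2 : ℤ)) (y ^ (2 * k)) := by
    rw [zpow_neg]; exact hcom.inv_left
  have hyx4 : y⁻¹ * x ^ (4 : ℤ) * y = x ^ (-4 : ℤ) * y ^ (4 * k) := by
    have e1 : Commute (d * x ^ (-2 : ℤ)) (c * y ^ (2 * k)) :=
      ((hcc _).symm).mul_right ((hdev k).mul_left hcom')
    calc y⁻¹ * x ^ (4 : ℤ) * y = (y⁻¹ * x ^ (2 : ℤ) * y) ^ (2 : ℤ) := by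
          rw [zpow_two]; group
      _ = (d * x ^ (-2 : ℤ) * (c * y ^ (2 * k))) ^ (2 : ℤ) := by rw [hyx, hi1]
      _ = (d ^ 2 * (x ^ (-2 : ℤ)) ^ (2 : ℤ)) * (c ^ 2 * (y ^ (2 * k)) ^ (2 : ℤ)) := by
          rw [e1.mul_zpow, (hdx.zpow_right _).mul_zpow, (hcc _).mul_zpow]; norm_cast
      _ = _ := by
          rw [hd2, hc2, one_mul, one_mul, ← zpow_mul, ← zpow_mul]; congr 2; ring
  have hcom4 : Commute (x ^ (-4 : ℤ)) (y ^ (4 * k)) := by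
    rw [show (-4 : ℤ) = -2 * 2 by norm_num, show 4 * k = 2 * k * 2 by ring, zpow_mul,
      zpow_mul y]
    exact (hcom'.zpow_left 2).zpow_right 2
  -- Raise the formula for y⁻¹x⁴y to the power 2^(α-3), using (x⁴)^(2^(α-3)) = d: then cd = d
  -- y^(4k·2^(α-3)), and cancelling d gives the second congruence.
  have hfin : y ^ (4 * k * 2 ^ (α - 3) + 2 ^ (β - 1)) = 1 := by
    have e0 : (x ^ (4 : ℤ)) ^ ((2 : ℤ) ^ (α - 3)) = d := by
      rw [← zpow_mul, hdd, ← zpow_natCast]; congr 1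
      obtain ⟨γ, rfl⟩ := Nat.exists_eq_add_of_le' hα3
      rw [show γ + 3 - 1 = γ + 2 from rfl, Nat.add_sub_cancel]; push_cast; ring
    have e1 := congrArg (· ^ ((2 : ℤ) ^ (α - 3))) hyx4
    have e2 : y⁻¹ * x ^ (4 : ℤ) * y = y⁻¹ * x ^ (4 : ℤ) * y⁻¹⁻¹ := by rw [inv_inv]
    simp only [e2, conj_zpow, hcom4.mul_zpow, e0] at e1
    rw [inv_inv, hydy, show (x ^ (-4 : ℤ)) = (x ^ (4 : ℤ))⁻¹ by group, inv_zpow, e0, hdi,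
      (hcc d).eq, ← zpow_mul] at e1
    rw [zpow_add, ← mul_left_cancel e1, ← hcz, ← sq, hc2]
  refine ⟨hα3, t, by rw [hkt]; ring, ?_, ?_⟩
  · convert hkd using 1; rw [hkt]; ring
  · convert hdvd _ hfin using 1
    obtain ⟨γ, rfl⟩ := Nat.exists_eq_add_of_le' hα3
    rw [hkt]; simp only [Nat.add_sub_cancel]; ring

/-- The presented group maps onto G. The congruences put its last relator in the form with c =
Y^(2^(β-1)), so all its elements are X^a Y^b; such an element dies in G only if x^a = y^b = 1, and
then the order relators kill it already. -/
theorem TightPair.isGP (h : TightPair x y (2 ^ α) (2 ^ β)) (hβ : 2 ≤ β) {i₁ j₁ i₂ j₂ : ℤ}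
    (h₁ : y⁻¹ * x = x ^ i₁ * y ^ j₁) (h₂ : y * x⁻¹ = x ^ i₂ * y ^ j₂) (hj : Odd j₁)
    (hi : (2 : ℤ) ^ α ∣ i₂ - -i₁) (hj₂ : (2 : ℤ) ^ β ∣ j₂ - (-j₁ + 2 ^ (β - 1))) :
    IsGP x y (2 ^ α) (2 ^ β) i₁ j₁ i₂ j₂ := by
  have hxn : x ^ 2 ^ α = 1 := by rw [← h.orderOf_left, pow_orderOf_eq_one]
  have hyn : y ^ 2 ^ β = 1 := by rw [← h.orderOf_right, pow_orderOf_eq_one]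
  let v : Fin 2 → G := ![x, y]
  have hv : ∀ r ∈ relators (2 ^ α) (2 ^ β) i₁ j₁ i₂ j₂, FreeGroup.lift v r = 1 := by
    rintro _ (rfl | rfl | rfl | rfl | rfl)
    · simpa [v] using hxn
    · simpa [v] using hyn
    · simpa [v] using h.sq_eq_one
    · simp [v, h₁]
    · simp [v, h₂]
  let f : GroupGP (2 ^ α) (2 ^ β) i₁ j₁ i₂ j₂ →* G := PresentedGroup.toGroup hv
  have hf0 : f (PresentedGroup.of 0) = x := PresentedGroup.toGroup.of hv
  have hf1 : f (PresentedGroup.of 1) = y := PresentedGroup.toGroup.of hv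
  have hrange : Set.range (PresentedGroup.of (rels := relators (2 ^ α) (2 ^ β) i₁ j₁ i₂ j₂)) =
      {PresentedGroup.of 0, PresentedGroup.of 1} := by
    ext g
    simp [Fin.exists_fin_two, eq_comm]
  have hgen : gen (PresentedGroup.of (rels := relators (2 ^ α) (2 ^ β) i₁ j₁ i₂ j₂) 0)
      (PresentedGroup.of 1) = ⊤ := by
    rw [gen, ← hrange, PresentedGroup.closure_range_of]
  have hrel : ∀ r ∈ relators (2 ^ α) (2 ^ β) i₁ j₁ i₂ j₂,
      PresentedGroup.mk (relators (2 ^ α) (2 ^ β) i₁ j₁ i₂ j₂) r = 1 := fun r hr =>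
    PresentedGroup.one_of_mem hr
  set X : GroupGP (2 ^ α) (2 ^ β) i₁ j₁ i₂ j₂ := PresentedGroup.of 0 with hX
  set Y : GroupGP (2 ^ α) (2 ^ β) i₁ j₁ i₂ j₂ := PresentedGroup.of 1 with hY
  have r1 : X ^ 2 ^ α = 1 := hrel _ (Or.inl rfl)
  have r2 : Y ^ 2 ^ β = 1 := hrel _ (Or.inr (Or.inl rfl))
  have r3 : (X * Y) ^ 2 = 1 := hrel _ (Or.inr (Or.inr (Or.inl rfl)))
  have r4 : Y⁻¹ * X = X ^ i₁ * Y ^ j₁ :=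
    mul_inv_eq_one.1 (hrel _ (Or.inr (Or.inr (Or.inr (Or.inl rfl)))))
  have r5 : Y * X⁻¹ = X ^ i₂ * Y ^ j₂ :=
    mul_inv_eq_one.1 (hrel _ (Or.inr (Or.inr (Or.inr (Or.inr rfl)))))
  have hinj : Function.Injective f := by
    rw [injective_iff_map_eq_one]
    intro g hg
    obtain ⟨a, b, rfl⟩ := exists_eq_zpow_mul_zpow_of_relations (c := Y ^ 2 ^ (β - 1))
      (by positivity) r1 r2 r3 r4 (by
        rw [r5, zpow_eq_zpow_of_dvd r1 (by exact_mod_cast hi),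
          zpow_eq_zpow_of_dvd r2 (by exact_mod_cast hj₂), zpow_add, mul_assoc]
        norm_cast)
      ((Commute.refl Y).pow_left _)
      (by rw [← pow_mul, ← pow_succ, Nat.sub_add_cancel (by omega), r2]) hj g (hgen ▸ trivial)
    rw [map_mul, map_zpow, map_zpow, hf0, hf1] at hg
    obtain ⟨ha, hb⟩ := h.eq_one_of_zpow_mul_zpow hg
    have ha' := orderOf_dvd_iff_zpow_eq_one.2 ha
    have hb' := orderOf_dvd_iff_zpow_eq_one.2 hb
    rw [h.orderOf_left] at ha'
    rw [h.orderOf_right] at hb'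
    rw [zpow_eq_zpow_of_dvd (b := 0) r1 (by simpa using ha'),
      zpow_eq_zpow_of_dvd (b := 0) r2 (by simpa using hb')]
    simp
  have hfr : f.range = gen x y := by
    rw [MonoidHom.range_eq_map, ← hgen, gen, MonoidHom.map_closure, Set.image_pair, hf0, hf1]
  exact ⟨(MonoidHom.ofInjective hinj).trans (MulEquiv.subgroupCongr hfr), hf0, hf1⟩

/-- The classification of the rotation groups of tight chiral polyhedra of two-power type whose
minimal quotients are reflexible. -/
theorem TightPair.classification (h : TightPair x y (2 ^ α) (2 ^ β)) (hαβ : α < β)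
    (hr : ¬ Reflexible x y)
    (hx : 1 ≤ α → ∀ (N : Subgroup G) [N.Normal], N = Subgroup.zpowers (x ^ 2 ^ (α - 1)) →
      Reflexible (x : G ⧸ N) (y : G ⧸ N))
    (hy : 1 ≤ β → ∀ (N : Subgroup G) [N.Normal], N = Subgroup.zpowers (y ^ 2 ^ (β - 1)) →
      Reflexible (x : G ⧸ N) (y : G ⧸ N)) :
    (α = 3 ∧ 5 ≤ β ∧
        (IsGP x y 8 (2 ^ β) 3 (1 + 2 ^ (β - 2)) (-3) (-1 + 2 ^ (β - 2)) ∨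
          IsGP x y 8 (2 ^ β) 3 (1 - 2 ^ (β - 2)) (-3) (-1 - 2 ^ (β - 2)))) ∨
      (β = α + 1 ∧ 4 ≤ α ∧
        (IsGP x y (2 ^ α) (2 ^ (α + 1))
            (-1 + 2 ^ (α - 1)) (-3 + 2 ^ (α - 1)) (1 + 2 ^ (α - 1)) (3 + 2 ^ (α - 1)) ∨
          IsGP x y (2 ^ α) (2 ^ (α + 1))
            (-1 + 2 ^ (α - 1)) (-3 - 2 ^ (α - 1)) (1 + 2 ^ (α - 1)) (3 - 2 ^ (α - 1)))) := by
  obtain ⟨hα, i, j, hj, hd, h₁, h₂⟩ := h.exists_relations hαβ hr hx hy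
  obtain ⟨hα3, t, rfl, d₁, d₂⟩ := h.dvd_exponents hαβ hα hj hd h₁ h₂
  have hxn : x ^ 2 ^ α = 1 := by rw [← h.orderOf_left, pow_orderOf_eq_one]
  have hyn : y ^ 2 ^ β = 1 := by rw [← h.orderOf_right, pow_orderOf_eq_one]
  have hi : x ^ i = x ^ (-1 + (2 : ℤ) ^ (α - 1)) := by
    rw [zpow_add, show (2 : ℤ) ^ (α - 1) = ((2 ^ (α - 1) : ℕ) : ℤ) by push_cast; rfl,
      zpow_natCast, ← hd]
    group
  have hc : y ^ 2 ^ (β - 1) = y ^ ((2 : ℤ) ^ (β - 1)) := by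
    rw [← zpow_natCast]; push_cast; rfl
  have key : ∀ (p : ℕ) (i₁ j₁ i₂ j₂ : ℤ), 2 ^ α = p → (2 : ℤ) ^ α ∣ -1 + 2 ^ (α - 1) - i₁ →
      (2 : ℤ) ^ α ∣ i₂ - -i₁ → (2 : ℤ) ^ β ∣ 4 * t + 1 - j₁ →
      (2 : ℤ) ^ β ∣ j₂ - (-j₁ + 2 ^ (β - 1)) → IsGP x y p (2 ^ β) i₁ j₁ i₂ j₂ := by
    rintro _ i₁ j₁ i₂ j₂ rfl e₃ e₄ e₁ e₂
    have hi₁ : x ^ i = x ^ i₁ := hi.trans (zpow_eq_zpow_of_dvd hxn (by exact_mod_cast e₃))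
    refine h.isGP (by omega) ?_ ?_ ?_ e₄ e₂
    · rw [h₁, hi₁, zpow_eq_zpow_of_dvd hyn (by exact_mod_cast e₁)]
    · rw [h₂, zpow_neg, hi₁, ← zpow_neg, hc, mul_assoc, ← zpow_add,
        zpow_eq_zpow_of_dvd (a := i₂) hxn (by exact_mod_cast e₄)]
      congr 1
      apply zpow_eq_zpow_of_dvd hyn
      obtain ⟨a, ha⟩ := e₁
      obtain ⟨b, hb⟩ := e₂
      exact ⟨-a - b, by push_cast; linarith⟩
    · have h2 : (2 : ℤ) ∣ 4 * t + 1 - j₁ := (dvd_pow_self 2 (by omega)).trans e₁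
      rw [Int.odd_iff]; omega
  rcases exponents_of_dvd hα3 hαβ d₁ d₂ with ⟨rfl, hβ, n, hn⟩ | ⟨rfl, hα4, n, hn⟩
  · refine Or.inl ⟨rfl, hβ, ?_⟩
    obtain ⟨γ, rfl⟩ := Nat.exists_eq_add_of_le' hβ
    have ht : t = 2 ^ (γ + 1) * (2 * n + 1) := hn
    -- j = 1 + 2^(β-2)(2n + 1) depends modulo 2^β only on the parity of n, which selects the sign.
    -- The second exponent is -j + 2^(β-1), and the extra half period restores the same sign.
    obtain ⟨m, rfl | rfl⟩ := n.even_or_odd'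
    · refine Or.inl (key _ _ _ _ _ (by norm_num) (by norm_num) (by norm_num) ⟨m, ?_⟩ ⟨0, ?_⟩)
      · rw [ht, show γ + 5 - 2 = γ + 3 from rfl]; ring
      · rw [show γ + 5 - 2 = γ + 3 from rfl, show γ + 5 - 1 = γ + 4 from rfl]; ring
    · refine Or.inr (key _ _ _ _ _ (by norm_num) (by norm_num) (by norm_num) ⟨m + 1, ?_⟩ ⟨-1, ?_⟩)
      · rw [ht, show γ + 5 - 2 = γ + 3 from rfl]; ring
      · rw [show γ + 5 - 2 = γ + 3 from rfl, show γ + 5 - 1 = γ + 4 from rfl]; ring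
  · refine Or.inr ⟨rfl, hα4, ?_⟩
    obtain ⟨γ, rfl⟩ := Nat.exists_eq_add_of_le' hα4
    have ht : t = 2 ^ (γ + 1) * (2 * n + 1) - 1 := eq_sub_of_add_eq hn
    have e₄ : (2 : ℤ) ^ (γ + 4) ∣ 1 + 2 ^ (γ + 4 - 1) - -(-1 + 2 ^ (γ + 4 - 1)) :=
      ⟨1, by rw [show γ + 4 - 1 = γ + 3 from rfl]; ring⟩
    obtain ⟨m, rfl | rfl⟩ := n.even_or_odd'
    · refine Or.inl (key _ _ _ _ _ rfl (by simp) e₄ ⟨m, ?_⟩ ⟨0, ?_⟩)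
      · rw [ht, show γ + 4 - 1 = γ + 3 from rfl]; ring
      · rw [show γ + 4 + 1 - 1 = γ + 4 from rfl, show γ + 4 - 1 = γ + 3 from rfl]; ring
    · refine Or.inr (key _ _ _ _ _ rfl (by simp) e₄ ⟨m + 1, ?_⟩ ⟨-1, ?_⟩)
      · rw [ht, show γ + 4 - 1 = γ + 3 from rfl]; ring
      · rw [show γ + 4 + 1 - 1 = γ + 4 from rfl, show γ + 4 - 1 = γ + 3 from rfl]; ring

end TwoPower

/-! ### Flags -/

section Flags

universe u

variable {P : Type u} [Polyhedron P]

open Polyhedron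

theorem fin_three_eq : ∀ i : Fin 3, i = 0 ∨ i = 1 ∨ i = 2 := by decide

theorem Flag.ext_elt {Φ Ψ : Flag P} (h : ∀ i, Φ.elt i = Ψ.elt i) : Φ = Ψ := by
  cases Φ; cases Ψ
  congr
  exact funext h

theorem exists_other_of_ncard_eq_two {α : Type*} {S : Set α} (hS : S.ncard = 2) {a : α}
    (ha : a ∈ S) : ∃ b ∈ S, b ≠ a ∧ ∀ c ∈ S, c ≠ a → c = b := by
  obtain ⟨x, y, hxy, rfl⟩ := Set.ncard_eq_two.1 hS
  obtain rfl | rfl := ha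
  · exact ⟨y, by simp, hxy.symm, by simp⟩
  · exact ⟨x, by simp, hxy, by simp⟩

theorem Flag.elt_mono (Φ : Flag P) {i j : Fin 3} (h : i ≤ j) : Φ.elt i ≤ Φ.elt j := by
  have h01 := Φ.vertex_le_edge
  have h12 := Φ.edge_le_face
  obtain rfl | rfl | rfl := fin_three_eq i <;> obtain rfl | rfl | rfl := fin_three_eq j <;>
    first
    | exact le_rfl
    | exact h01
    | exact h12
    | exact h01.trans h12
    | exact absurd h (by decide)

/-- The flag with given vertex, edge and face. -/
def Flag.ofTriple (v e f : P) (hv : rank v = 0) (he : rank e = 1) (hf : rank f = 2) (hve : v ≤ e)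
    (hef : e ≤ f) : Flag P where
  elt := ![v, e, f]
  rank_elt i := by obtain rfl | rfl | rfl := fin_three_eq i <;> assumption
  vertex_le_edge := hve
  edge_le_face := hef

theorem Flag.exists_unique_adj (i : Fin 3) (Φ : Flag P) :
    ∃ Ψ, Φ.IsAdj i Ψ ∧ ∀ Ω, Φ.IsAdj i Ω → Ω = Ψ := by
  have h0 := Φ.rank_elt 0
  have h1 := Φ.rank_elt 1
  have h2 := Φ.rank_elt 2
  have h01 := Φ.vertex_le_edge
  have h12 := Φ.edge_le_face
  obtain rfl | rfl | rfl := fin_three_eq i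
  · obtain ⟨b, ⟨hb, hbe⟩, hne, huniq⟩ := exists_other_of_ncard_eq_two (edge_vertices _ h1)
      (a := Φ.elt 0) ⟨h0, h01⟩
    refine ⟨Flag.ofTriple b (Φ.elt 1) (Φ.elt 2) hb h1 h2 hbe h12, ⟨hne.symm, ?_⟩, ?_⟩
    · intro j hj
      obtain rfl | rfl | rfl := fin_three_eq j
      exacts [absurd rfl hj, rfl, rfl]
    · rintro Ω ⟨hΩ, hΩ'⟩
      have e1 := hΩ' 1 (by decide)
      have e2 := hΩ' 2 (by decide)
      refine Flag.ext_elt fun j => ?_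
      obtain rfl | rfl | rfl := fin_three_eq j
      · exact huniq _ ⟨Ω.rank_elt 0, e1 ▸ Ω.vertex_le_edge⟩ hΩ.symm
      · exact e1.symm
      · exact e2.symm
  · obtain ⟨b, ⟨hb, hvb, hbf⟩, hne, huniq⟩ := exists_other_of_ncard_eq_two
      (diamond _ _ h0 h2 (h01.trans h12)) (a := Φ.elt 1) ⟨h1, h01, h12⟩
    refine ⟨Flag.ofTriple (Φ.elt 0) b (Φ.elt 2) h0 hb h2 hvb hbf, ⟨hne.symm, ?_⟩, ?_⟩
    · intro j hj
      obtain rfl | rfl | rfl := fin_three_eq j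
      exacts [rfl, absurd rfl hj, rfl]
    · rintro Ω ⟨hΩ, hΩ'⟩
      have e0 := hΩ' 0 (by decide)
      have e2 := hΩ' 2 (by decide)
      refine Flag.ext_elt fun j => ?_
      obtain rfl | rfl | rfl := fin_three_eq j
      · exact e0.symm
      · exact huniq _ ⟨Ω.rank_elt 1, e0 ▸ Ω.vertex_le_edge, e2 ▸ Ω.edge_le_face⟩ hΩ.symm
      · exact e2.symm
  · obtain ⟨b, ⟨hb, heb⟩, hne, huniq⟩ := exists_other_of_ncard_eq_two (edge_faces _ h1)
      (a := Φ.elt 2) ⟨h2, h12⟩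
    refine ⟨Flag.ofTriple (Φ.elt 0) (Φ.elt 1) b h0 h1 hb h01 heb, ⟨hne.symm, ?_⟩, ?_⟩
    · intro j hj
      obtain rfl | rfl | rfl := fin_three_eq j
      exacts [rfl, rfl, absurd rfl hj]
    · rintro Ω ⟨hΩ, hΩ'⟩
      have e0 := hΩ' 0 (by decide)
      have e1 := hΩ' 1 (by decide)
      refine Flag.ext_elt fun j => ?_
      obtain rfl | rfl | rfl := fin_three_eq j
      · exact e0.symm
      · exact e1.symm
      · exact huniq _ ⟨Ω.rank_elt 2, e1 ▸ Ω.edge_le_face⟩ hΩ.symm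

/-- The flag `Φ^i`. -/
noncomputable def Flag.adj (i : Fin 3) (Φ : Flag P) : Flag P :=
  (Flag.exists_unique_adj i Φ).choose

theorem Flag.isAdj_adj (i : Fin 3) (Φ : Flag P) : Φ.IsAdj i (Φ.adj i) :=
  (Flag.exists_unique_adj i Φ).choose_spec.1

theorem Flag.IsAdj.eq_adj {i : Fin 3} {Φ Ψ : Flag P} (h : Φ.IsAdj i Ψ) : Ψ = Φ.adj i :=
  (Flag.exists_unique_adj i Φ).choose_spec.2 Ψ h

theorem Flag.isAdj_iff {i : Fin 3} {Φ Ψ : Flag P} : Φ.IsAdj i Ψ ↔ Ψ = Φ.adj i :=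
  ⟨IsAdj.eq_adj, fun h => h ▸ Φ.isAdj_adj i⟩

theorem Flag.adj_elt (Φ : Flag P) {i j : Fin 3} (h : j ≠ i) : (Φ.adj i).elt j = Φ.elt j :=
  ((Φ.isAdj_adj i).2 j h).symm

theorem Flag.adj_adj (i : Fin 3) (Φ : Flag P) : (Φ.adj i).adj i = Φ :=
  (Flag.IsAdj.eq_adj ⟨(Φ.isAdj_adj i).1.symm, fun _ h => Φ.adj_elt h⟩).symm

theorem Flag.eq_or_eq_adj {i : Fin 3} {Φ Ψ : Flag P} (h : ∀ j, j ≠ i → Φ.elt j = Ψ.elt j) :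
    Ψ = Φ ∨ Ψ = Φ.adj i := by
  by_cases h' : Φ.elt i = Ψ.elt i
  · left
    refine Flag.ext_elt fun j => ?_
    by_cases hj : j = i
    · rw [hj, h']
    · exact (h j hj).symm
  · exact Or.inr (Flag.IsAdj.eq_adj ⟨h', h⟩)

/-- Both changes leave the edge alone, and an edge has only one other vertex, whichever of its faces
is chosen. -/
theorem Flag.adj_zero_two (Φ : Flag P) : (Φ.adj 0).adj 2 = (Φ.adj 2).adj 0 := by
  refine (Flag.IsAdj.eq_adj ⟨?_, ?_⟩).symm
  · rw [Flag.adj_elt _ (by decide)]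
    intro h
    have h1 : ((Φ.adj 2).adj 0).elt 2 = (Φ.adj 2).elt 2 := Flag.adj_elt _ (by decide)
    rw [← h] at h1
    exact (Φ.isAdj_adj 2).1 h1
  · intro j hj
    obtain rfl | rfl | rfl := fin_three_eq j
    · rcases Flag.eq_or_eq_adj (i := 0) (Φ := Φ) (Ψ := Flag.ofTriple (((Φ.adj 2).adj 0).elt 0)
        (Φ.elt 1) (Φ.elt 2) (Flag.rank_elt _ _) (Flag.rank_elt _ _) (Flag.rank_elt _ _)
        (by
          have h1 := ((Φ.adj 2).adj 0).vertex_le_edge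
          rwa [Flag.adj_elt _ (i := 0) (j := 1) (by decide),
            Flag.adj_elt _ (i := 2) (j := 1) (by decide)] at h1)
        Φ.edge_le_face) (by
          intro j hj
          obtain rfl | rfl | rfl := fin_three_eq j
          exacts [absurd rfl hj, rfl, rfl]) with h | h
      · exfalso
        have h1 := congrArg (fun Ω : Flag P => Ω.elt 0) h
        change ((Φ.adj 2).adj 0).elt 0 = Φ.elt 0 at h1
        have h2 := ((Φ.adj 2).isAdj_adj 0).1
        rw [h1] at h2
        exact h2 (Φ.adj_elt (by decide))
      · exact (congrArg (fun Ω : Flag P => Ω.elt 0) h).symm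
    · rw [Flag.adj_elt _ (by decide), Flag.adj_elt _ (by decide), Flag.adj_elt _ (by decide)]
    · exact absurd rfl hj

/-! ### Flag connectivity -/

theorem rank_mono {x y : P} (h : x ≤ y) : rank x ≤ rank y := rank_strictMono.monotone h

theorem le_of_rank_lt {x y : P} (h : x ≤ y ∨ y ≤ x) (hr : rank x < rank y) : x ≤ y :=
  h.resolve_right fun h' => absurd (rank_mono h') (not_le.2 hr)

theorem rank_ne_of_adj {x y : P} (h : (incidenceGraph P).Adj x y) : rank x ≠ rank y := by
  obtain ⟨hne, h | h⟩ := h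
  · exact (rank_strictMono (lt_of_le_of_ne h hne)).ne
  · exact (rank_strictMono (lt_of_le_of_ne h hne.symm)).ne'

theorem exists_flag_of_adj_of_adj {x y z : P} (hxy : (incidenceGraph P).Adj x y)
    (hxz : (incidenceGraph P).Adj x z) (hyz : (incidenceGraph P).Adj y z) :
    ∃ Φ : Flag P, Φ.elt (rank x) = x ∧ Φ.elt (rank y) = y ∧ Φ.elt (rank z) = z := by
  have r1 := rank_ne_of_adj hxy
  have r2 := rank_ne_of_adj hxz
  have r3 := rank_ne_of_adj hyz
  have key : ∀ a b c i : Fin 3, a ≠ b → a ≠ c → b ≠ c → i ≠ a → i ≠ b → i = c := by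
    intro a b c i; omega
  let e : Fin 3 → P := fun i => if i = rank x then x else if i = rank y then y else z
  have ex : e (rank x) = x := by simp [e]
  have ey : e (rank y) = y := by simp [e, r1.symm]
  have ez : e (rank z) = z := by simp [e, r2.symm, r3.symm]
  have hr : ∀ i, rank (e i) = i := by
    intro i
    by_cases h1 : i = rank x
    · rw [h1, ex]
    by_cases h2 : i = rank y
    · rw [h2, ey]
    · rw [key _ _ _ i r1 r2 r3 h1 h2, ez]
  have hc : ∀ i j, e i ≤ e j ∨ e j ≤ e i := by
    have hmem : ∀ i, e i = x ∨ e i = y ∨ e i = z := by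
      intro i
      simp only [e]
      split_ifs <;> simp
    intro i j
    have a1 := hxy.2
    have a2 := hxz.2
    have a3 := hyz.2
    rcases hmem i with h | h | h <;> rcases hmem j with h' | h' | h' <;> rw [h, h'] <;>
      first
      | exact Or.inl le_rfl
      | assumption
      | exact Or.symm (by assumption)
  exact ⟨⟨e, hr, le_of_rank_lt (hc 0 1) (by rw [hr, hr]; decide),
    le_of_rank_lt (hc 1 2) (by rw [hr, hr]; decide)⟩, ex, ey, ez⟩

theorem exists_flag_of_lt {x y : P} (h : x < y) :
    ∃ Φ : Flag P, Φ.elt (rank x) = x ∧ Φ.elt (rank y) = y := by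
  have hr := rank_strictMono h
  have hadj : (incidenceGraph P).Adj x y := ⟨h.ne, Or.inl h.le⟩
  suffices ∃ z, (incidenceGraph P).Adj x z ∧ (incidenceGraph P).Adj y z by
    obtain ⟨z, hz, hz'⟩ := this
    obtain ⟨Φ, h1, h2, -⟩ := exists_flag_of_adj_of_adj hadj hz hz'
    exact ⟨Φ, h1, h2⟩
  have adj_of_lt : ∀ {a b : P}, a ≤ b → rank a < rank b →
      (incidenceGraph P).Adj a b ∧ (incidenceGraph P).Adj b a := by
    intro a b hab hrab
    have : a ≠ b := by rintro rfl; exact lt_irrefl _ hrab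
    exact ⟨⟨this, Or.inl hab⟩, ⟨this.symm, Or.inr hab⟩⟩
  have pick : ∀ {S : Set P}, S.ncard = 2 → S.Nonempty := by
    intro S hS
    exact Set.nonempty_of_ncard_ne_zero (by rw [hS]; decide)
  obtain hx | hx | hx := fin_three_eq (rank x) <;> obtain hy | hy | hy := fin_three_eq (rank y) <;>
    rw [hx, hy] at hr <;> try exact absurd hr (by decide)
  · obtain ⟨f, hf, hyf⟩ := pick (edge_faces y hy)
    exact ⟨f, (adj_of_lt (h.le.trans hyf) (by rw [hx, hf]; decide)).1,
      (adj_of_lt hyf (by rw [hy, hf]; decide)).1⟩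
  · obtain ⟨e, he, hxe, hey⟩ := pick (diamond x y hx hy h.le)
    exact ⟨e, (adj_of_lt hxe (by rw [hx, he]; decide)).1,
      (adj_of_lt hey (by rw [hy, he]; decide)).2⟩
  · obtain ⟨v, hv, hvx⟩ := pick (edge_vertices x hx)
    exact ⟨v, (adj_of_lt hvx (by rw [hx, hv]; decide)).2,
      (adj_of_lt (hvx.trans h.le) (by rw [hy, hv]; decide)).2⟩

theorem exists_flag_of_adj {x y : P} (h : (incidenceGraph P).Adj x y) :
    ∃ Φ : Flag P, Φ.elt (rank x) = x ∧ Φ.elt (rank y) = y := by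
  obtain ⟨hne, h | h⟩ := h
  · exact exists_flag_of_lt (lt_of_le_of_ne h hne)
  · obtain ⟨Φ, h1, h2⟩ := exists_flag_of_lt (lt_of_le_of_ne h hne.symm)
    exact ⟨Φ, h2, h1⟩

theorem exists_flag (x : P) : ∃ Φ : Flag P, Φ.elt (rank x) = x := by
  suffices ∃ y, (incidenceGraph P).Adj x y by
    obtain ⟨y, hy⟩ := this
    exact (exists_flag_of_adj hy).imp fun _ h => h.1
  by_cases hx : rank x = 0 ∨ rank x = 2
  · obtain ⟨⟨y, hy⟩⟩ := (link_connected x hx).nonempty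
    exact ⟨y, hy⟩
  · have hx1 : rank x = 1 := by
      obtain h | h | h := fin_three_eq (rank x)
      exacts [absurd (Or.inl h) hx, h, absurd (Or.inr h) hx]
    obtain ⟨f, hf, hxf⟩ := Set.nonempty_of_ncard_ne_zero
      (by rw [edge_faces x hx1]; decide : {f : P | rank f = 2 ∧ x ≤ f}.ncard ≠ 0)
    refine ⟨f, ?_, Or.inl hxf⟩
    rintro rfl
    rw [hx1] at hf
    exact absurd hf (by decide)

theorem exists_flag_of_le {x y : P} (h : x ≤ y) :
    ∃ Φ : Flag P, Φ.elt (rank x) = x ∧ Φ.elt (rank y) = y := by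
  obtain rfl | h := h.eq_or_lt
  · exact (exists_flag x).imp fun _ h => ⟨h, h⟩
  · exact exists_flag_of_lt h

theorem Flag.adj_graph (Φ : Flag P) {i j : Fin 3} (h : i ≠ j) :
    (incidenceGraph P).Adj (Φ.elt i) (Φ.elt j) := by
  refine ⟨fun h' => h ?_, ?_⟩
  · rw [← Φ.rank_elt i, h', Φ.rank_elt]
  · rcases le_total i j with h | h
    exacts [Or.inl (Φ.elt_mono h), Or.inr (Φ.elt_mono h)]

/-- Any two flags containing `x` are connected by adjacencies that preserve `x`. -/
theorem Flag.induction_on_elt (x : P) (p : Flag P → Prop)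
    (hp : ∀ i ≠ rank x, ∀ Φ : Flag P, Φ.elt (rank x) = x → p Φ → p (Φ.adj i)) {Φ Ψ : Flag P}
    (hΦ : Φ.elt (rank x) = x) (hΨ : Ψ.elt (rank x) = x) (h : p Φ) : p Ψ := by
  by_cases hx : rank x = 0 ∨ rank x = 2
  · have third : ∀ a b : Fin 3, a ≠ b → ∃ k, k ≠ a ∧ ∀ j, j ≠ k → j = a ∨ j = b := by decide
    -- Two flags through x that share one further element differ in at most one place, so a single
    -- adjacency joins them. Walking along the connected link of x reaches all flags through x.
    have claim : ∀ {Θ : Flag P} {j : Fin 3}, j ≠ rank x → Θ.elt (rank x) = x → p Θ →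
        ∀ Ω : Flag P, Ω.elt (rank x) = x → Ω.elt j = Θ.elt j → p Ω := by
      intro Θ j hj hΘ hpΘ Ω hΩ hΩj
      obtain ⟨k, hk, hk'⟩ := third _ _ hj.symm
      rcases Flag.eq_or_eq_adj (i := k) (Φ := Θ) (Ψ := Ω) (by
        intro l hl
        rcases hk' l hl with rfl | rfl
        exacts [hΘ.trans hΩ.symm, hΩj.symm]) with rfl | rfl
      exacts [hpΘ, hp k hk Θ hΘ hpΘ]
    obtain ⟨j, hj⟩ : ∃ j : Fin 3, j ≠ rank x := exists_ne _
    have mem : ∀ Θ : Flag P, Θ.elt (rank x) = x → (incidenceGraph P).Adj x (Θ.elt j) := by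
      intro Θ hΘ
      have := Θ.adj_graph hj.symm
      rwa [hΘ] at this
    have hreach := (SimpleGraph.reachable_iff_reflTransGen _ _).1
      ((link_connected x hx).preconnected ⟨Φ.elt j, mem Φ hΦ⟩ ⟨Ψ.elt j, mem Ψ hΨ⟩)
    have key : ∀ Ω : Flag P, Ω.elt (rank x) = x →
        Ω.elt (rank (Ψ.elt j)) = Ψ.elt j → p Ω := by
      refine Relation.ReflTransGen.rec (motive := fun y _ => ∀ Ω : Flag P, Ω.elt (rank x) = x →
        Ω.elt (rank y.1) = y.1 → p Ω) ?_ ?_ hreach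
      · intro Ω hΩ hΩ'
        refine claim hj hΦ h Ω hΩ ?_
        rwa [Φ.rank_elt] at hΩ'
      · rintro ⟨y, hy⟩ ⟨z, hz⟩ - hyz ih Ω hΩ hΩ'
        have hyz : (incidenceGraph P).Adj y z := hyz
        obtain ⟨Θ, t1, t2, t3⟩ := exists_flag_of_adj_of_adj hy hz hyz
        exact claim (rank_ne_of_adj hz).symm t1 (ih Θ t1 t2) Ω hΩ (hΩ'.trans t3.symm)
    exact key Ψ hΨ (by rw [Ψ.rank_elt])
  -- The link axiom does not cover edges; here one change of vertex and one of face suffice.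
  · have hx1 : rank x = 1 := by
      obtain h | h | h := fin_three_eq (rank x)
      exacts [absurd (Or.inl h) hx, h, absurd (Or.inr h) hx]
    rw [hx1] at hp hΦ hΨ
    have step : ∀ Θ : Flag P, Θ.elt 1 = x → p Θ → Θ.elt 0 = Ψ.elt 0 → p Ψ := by
      intro Θ hΘ hpΘ h0
      rcases Flag.eq_or_eq_adj (i := 2) (Φ := Θ) (Ψ := Ψ) (by
        intro l hl
        obtain rfl | rfl | rfl := fin_three_eq l
        exacts [h0, hΘ.trans hΨ.symm, absurd rfl hl]) with rfl | rfl
      exacts [hpΘ, hp 2 (by decide) Θ hΘ hpΘ]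
    rcases Flag.eq_or_eq_adj (i := 0) (Φ := Φ) (Ψ := Flag.ofTriple (Ψ.elt 0) (Φ.elt 1) (Φ.elt 2)
      (Flag.rank_elt _ _) (Flag.rank_elt _ _) (Flag.rank_elt _ _)
      (by rw [hΦ, ← hΨ]; exact Ψ.vertex_le_edge) Φ.edge_le_face) (by
        intro j hj
        obtain rfl | rfl | rfl := fin_three_eq j
        exacts [absurd rfl hj, rfl, rfl]) with h' | h'
    · exact step Φ hΦ h (congrArg (fun Ω : Flag P => Ω.elt 0) h').symm
    · exact step (Φ.adj 0) ((Φ.adj_elt (by decide)).trans hΦ) (hp 0 (by decide) Φ hΦ h)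
        (congrArg (fun Ω : Flag P => Ω.elt 0) h').symm

/-- Polyhedra are flag-connected. -/
theorem Flag.induction (p : Flag P → Prop) (hp : ∀ i (Φ : Flag P), p Φ → p (Φ.adj i))
    {Φ : Flag P} (h : p Φ) (Ψ : Flag P) : p Ψ := by
  have claim : ∀ {Θ : Flag P} {y : P}, Θ.elt (rank y) = y → p Θ →
      ∀ Ω : Flag P, Ω.elt (rank y) = y → p Ω := fun hΘ hpΘ Ω hΩ =>
    Flag.induction_on_elt _ p (fun i _ Φ _ => hp i Φ) hΘ hΩ hpΘ
  have hreach := (SimpleGraph.reachable_iff_reflTransGen _ _).1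
    ((connected (P := P)).preconnected (Φ.elt 0) (Ψ.elt 0))
  have key : ∀ Ω : Flag P, Ω.elt (rank (Ψ.elt 0)) = Ψ.elt 0 → p Ω := by
    refine Relation.ReflTransGen.rec (motive := fun y _ => ∀ Ω : Flag P,
      Ω.elt (rank y) = y → p Ω) ?_ ?_ hreach
    · exact claim (by rw [Φ.rank_elt]) h
    · intro y z _ hyz ih
      obtain ⟨Θ, t1, t2⟩ := exists_flag_of_adj hyz
      exact claim t2 (ih Θ t1)
  exact key Ψ (by rw [Ψ.rank_elt])

/-! ### The action of the automorphism group on flags -/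

/-- A flag maps to a chain of three elements of strictly increasing rank, and in `Fin 3` these ranks
can only be 0, 1, 2. -/
theorem rank_apply (g : P ≃o P) (x : P) : rank (g x) = rank x := by
  obtain ⟨Φ, hΦ⟩ := exists_flag x
  have h01 : rank (g (Φ.elt 0)) < rank (g (Φ.elt 1)) := rank_strictMono (g.strictMono
    (lt_of_le_of_ne Φ.vertex_le_edge (Φ.adj_graph (by decide)).1))
  have h12 : rank (g (Φ.elt 1)) < rank (g (Φ.elt 2)) := rank_strictMono (g.strictMono
    (lt_of_le_of_ne Φ.edge_le_face (Φ.adj_graph (by decide)).1))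
  have key : ∀ a b c : Fin 3, a < b → b < c → a = 0 ∧ b = 1 ∧ c = 2 := by decide
  obtain ⟨k0, k1, k2⟩ := key _ _ _ h01 h12
  have : ∀ i, rank (g (Φ.elt i)) = i := by
    intro i
    obtain rfl | rfl | rfl := fin_three_eq i <;> assumption
  rw [← hΦ, this, Φ.rank_elt]

/-- The right action of automorphisms on flags. -/
def Flag.act (Φ : Flag P) (g : Aut P) : Flag P where
  elt i := g.unop (Φ.elt i)
  rank_elt i := by rw [rank_apply, Φ.rank_elt]
  vertex_le_edge := g.unop.monotone Φ.vertex_le_edge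
  edge_le_face := g.unop.monotone Φ.edge_le_face

theorem Flag.act_mul (Φ : Flag P) (g h : Aut P) : Φ.act (g * h) = (Φ.act g).act h := rfl

theorem Flag.act_one (Φ : Flag P) : Φ.act 1 = Φ := rfl

theorem Flag.act_adj (Φ : Flag P) (g : Aut P) (i : Fin 3) :
    (Φ.adj i).act g = (Φ.act g).adj i :=
  Flag.IsAdj.eq_adj ⟨fun h => (Φ.isAdj_adj i).1 (g.unop.injective h),
    fun j hj => congrArg g.unop ((Φ.isAdj_adj i).2 j hj)⟩

theorem sends_iff {g : Aut P} {Φ Ψ : Flag P} : Sends g Φ Ψ ↔ Φ.act g = Ψ :=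
  ⟨fun h => Flag.ext_elt h, fun h _ => h ▸ rfl⟩

theorem Flag.eq_act_inv {Φ Ψ : Flag P} {g : Aut P} (h : Ψ.act g = Φ) : Ψ = Φ.act g⁻¹ := by
  rw [← h, ← act_mul, mul_inv_cancel, act_one]

/-- The action commutes with adjacency, so two automorphisms that agree on one flag agree on all
flags, by connectivity. -/
theorem Flag.act_injective (Φ : Flag P) {g h : Aut P} (hgh : Φ.act g = Φ.act h) : g = h := by
  have h1 := Flag.induction (fun Ψ : Flag P => Ψ.act g = Ψ.act h)
    (fun i Ψ hΨ => by rw [act_adj, act_adj, hΨ]) hgh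
  apply MulOpposite.unop_injective
  ext x
  obtain ⟨Ψ, hΨ⟩ := exists_flag x
  have := congrArg (fun Ω : Flag P => Ω.elt (rank x)) (h1 Ψ)
  change g.unop (Ψ.elt (rank x)) = h.unop (Ψ.elt (rank x)) at this
  rwa [hΨ] at this

theorem isRotationPair_iff {Φ : Flag P} {s₁ s₂ : Aut P} : IsRotationPair Φ s₁ s₂ ↔
    Φ.act s₁ = (Φ.adj 1).adj 0 ∧ Φ.act s₂ = (Φ.adj 2).adj 1 := by
  simp [IsRotationPair, Flag.isAdj_iff, sends_iff]

/-- A permutation of the flags that commutes with the adjacencies comes from an automorphism. -/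
theorem exists_aut_of_flag_perm (θ : Equiv.Perm (Flag P))
    (hθ : ∀ i Φ, θ (Φ.adj i) = (θ Φ).adj i) : ∃ g : Aut P, ∀ Φ : Flag P, Φ.act g = θ Φ := by
  choose fl hfl using fun x : P => exists_flag x
  -- The choice of the flag `fl x` is immaterial: the flags through x are joined by adjacencies of
  -- ranks other than that of x, and these do not affect the element of that rank in the image.
  have key : ∀ θ : Equiv.Perm (Flag P), (∀ i Φ, θ (Φ.adj i) = (θ Φ).adj i) → ∀ (Φ : Flag P) (i),
      (θ (fl (Φ.elt i))).elt (rank (Φ.elt i)) = (θ Φ).elt i := by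
    intro θ hθ Φ i
    have h := Flag.induction_on_elt (Φ.elt i)
      (fun Ψ : Flag P => (θ Ψ).elt (rank (Φ.elt i)) = (θ Φ).elt i)
      (fun j hj Ψ _ h => by rw [hθ, Flag.adj_elt _ hj.symm, h])
      (Φ := Φ) (Ψ := fl (Φ.elt i)) (by rw [Φ.rank_elt]) (hfl _) (by rw [Φ.rank_elt])
    exact h
  have hθ' : ∀ i Φ, θ.symm (Φ.adj i) = (θ.symm Φ).adj i := by
    intro i Φ
    rw [Equiv.symm_apply_eq, hθ, Equiv.apply_symm_apply]
  have inv : ∀ θ θ' : Equiv.Perm (Flag P), (∀ i Φ, θ (Φ.adj i) = (θ Φ).adj i) →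
      (∀ i Φ, θ' (Φ.adj i) = (θ' Φ).adj i) → (∀ Φ, θ' (θ Φ) = Φ) → ∀ x : P,
      (θ' (fl ((θ (fl x)).elt (rank x)))).elt (rank ((θ (fl x)).elt (rank x))) = x := by
    intro θ θ' _ h' hinv x
    rw [key θ' h', hinv, hfl]
  have mono : ∀ θ : Equiv.Perm (Flag P), (∀ i Φ, θ (Φ.adj i) = (θ Φ).adj i) →
      Monotone fun x : P => (θ (fl x)).elt (rank x) := by
    intro θ hθ x y hxy
    obtain ⟨Φ, h1, h2⟩ := exists_flag_of_le hxy
    have k1 := key θ hθ Φ (rank x)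
    have k2 := key θ hθ Φ (rank y)
    rw [h1] at k1
    rw [h2] at k2
    simp only [k1, k2]
    exact Flag.elt_mono _ (rank_mono hxy)
  let e : P ≃ P :=
    { toFun := fun x => (θ (fl x)).elt (rank x)
      invFun := fun x => (θ.symm (fl x)).elt (rank x)
      left_inv := inv θ θ.symm hθ hθ' θ.symm_apply_apply
      right_inv := inv θ.symm θ hθ' hθ θ.apply_symm_apply }
  exact ⟨MulOpposite.op (e.toOrderIso (mono θ hθ) (mono θ.symm hθ')),
    fun Φ => Flag.ext_elt fun i => key θ hθ Φ i⟩

end Flags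

/-! ### Rotation groups of chiral polyhedra -/

section Rotation

universe u

variable {P : Type u} [Polyhedron P] {Φ : Flag P} {s₁ s₂ : Aut P}

open Polyhedron

/-- This and the next three identities write the neighbours of Φ and of Φ^1 as images of these two
flags under the generators. Flag arguments thereby become computations with words. -/
theorem IsRotationPair.adj_zero (h : IsRotationPair Φ s₁ s₂) :
    Φ.adj 0 = (Φ.adj 1).act s₁⁻¹ := by
  obtain ⟨h1, -⟩ := isRotationPair_iff.1 h
  apply Flag.eq_act_inv
  rw [Flag.act_adj, h1, Flag.adj_adj]

theorem IsRotationPair.adj_two (h : IsRotationPair Φ s₁ s₂) :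
    Φ.adj 2 = (Φ.adj 1).act s₂ := by
  obtain ⟨-, h2⟩ := isRotationPair_iff.1 h
  rw [Flag.act_adj, h2, Flag.adj_adj]

theorem IsRotationPair.adj_one_zero (h : IsRotationPair Φ s₁ s₂) :
    (Φ.adj 1).adj 0 = Φ.act s₁ :=
  (isRotationPair_iff.1 h).1.symm

theorem IsRotationPair.adj_one_two (h : IsRotationPair Φ s₁ s₂) :
    (Φ.adj 1).adj 2 = Φ.act s₂⁻¹ := by
  apply Flag.eq_act_inv
  rw [Flag.act_adj, Flag.act_adj, (isRotationPair_iff.1 h).2, Flag.adj_adj, Flag.adj_adj]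

theorem IsRotationPair.mul_sq (h : IsRotationPair Φ s₁ s₂) : (s₁ * s₂) ^ 2 = 1 := by
  apply Φ.act_injective
  obtain ⟨h1, h2⟩ := isRotationPair_iff.1 h
  have key : Φ.act (s₁ * s₂) = (Φ.adj 2).adj 0 := by
    rw [Flag.act_mul, h1, Flag.act_adj, Flag.act_adj, h2, Flag.adj_adj]
  rw [sq, Flag.act_mul, key, Flag.act_adj, Flag.act_adj, key, Flag.act_one, Flag.adj_zero_two,
    Flag.adj_adj, Flag.adj_adj]

/-- An automorphism that sends the base flag to its `1`-adjacent flag inverts the generators. -/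
theorem IsRotationPair.conj_eq_inv (h : IsRotationPair Φ s₁ s₂) {g : Aut P}
    (hg : Φ.act g = Φ.adj 1) : g⁻¹ * s₁ * g = s₁⁻¹ ∧ g⁻¹ * s₂ * g = s₂⁻¹ := by
  obtain ⟨h1, h2⟩ := isRotationPair_iff.1 h
  have hg' : (Φ.adj 1).act g⁻¹ = Φ := (Flag.eq_act_inv hg).symm
  constructor <;> apply (Φ.adj 1).act_injective <;> rw [Flag.act_mul, Flag.act_mul, hg']
  · rw [h1, ← h.adj_zero, Flag.act_adj, Flag.act_adj, hg, Flag.adj_adj]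
  · rw [h2, Flag.act_adj, Flag.act_adj, hg, Flag.act_adj, ← h.adj_one_two]

theorem IsRotationPair.exists_of_elt_two (h : IsRotationPair Φ s₁ s₂) {Ψ : Flag P}
    (hΨ : Ψ.elt 2 = Φ.elt 2) :
    ∃ k : ℤ, Ψ = Φ.act (s₁ ^ k) ∨ Ψ = (Φ.adj 1).act (s₁ ^ k) := by
  refine Flag.induction_on_elt (Φ.elt 2)
    (fun Ψ : Flag P => ∃ k : ℤ, Ψ = Φ.act (s₁ ^ k) ∨ Ψ = (Φ.adj 1).act (s₁ ^ k)) ?_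
    (Φ := Φ) (by rw [Φ.rank_elt]) (by rwa [Φ.rank_elt]) ⟨0, Or.inl rfl⟩
  rw [Φ.rank_elt]
  rintro i hi _ - ⟨k, rfl | rfl⟩
  · obtain rfl | rfl | rfl := fin_three_eq i
    · exact ⟨-1 + k, Or.inr (by
        rw [← Flag.act_adj, h.adj_zero, ← Flag.act_mul, zpow_add, zpow_neg_one])⟩
    · exact ⟨k, Or.inr (Flag.act_adj _ _ _).symm⟩
    · exact absurd rfl hi
  · obtain rfl | rfl | rfl := fin_three_eq i
    · exact ⟨1 + k, Or.inl (by
        rw [← Flag.act_adj, h.adj_one_zero, ← Flag.act_mul, zpow_one_add])⟩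
    · exact ⟨k, Or.inl (by rw [← Flag.act_adj, Flag.adj_adj])⟩
    · exact absurd rfl hi

theorem IsRotationPair.exists_of_elt_zero (h : IsRotationPair Φ s₁ s₂) {Ψ : Flag P}
    (hΨ : Ψ.elt 0 = Φ.elt 0) :
    ∃ k : ℤ, Ψ = Φ.act (s₂ ^ k) ∨ Ψ = (Φ.adj 1).act (s₂ ^ k) := by
  refine Flag.induction_on_elt (Φ.elt 0)
    (fun Ψ : Flag P => ∃ k : ℤ, Ψ = Φ.act (s₂ ^ k) ∨ Ψ = (Φ.adj 1).act (s₂ ^ k)) ?_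
    (Φ := Φ) (by rw [Φ.rank_elt]) (by rwa [Φ.rank_elt]) ⟨0, Or.inl rfl⟩
  rw [Φ.rank_elt]
  rintro i hi _ - ⟨k, rfl | rfl⟩
  · obtain rfl | rfl | rfl := fin_three_eq i
    · exact absurd rfl hi
    · exact ⟨k, Or.inr (Flag.act_adj _ _ _).symm⟩
    · exact ⟨1 + k, Or.inr (by
        rw [← Flag.act_adj, h.adj_two, ← Flag.act_mul, zpow_one_add])⟩
  · obtain rfl | rfl | rfl := fin_three_eq i
    · exact absurd rfl hi
    · exact ⟨k, Or.inl (by rw [← Flag.act_adj, Flag.adj_adj])⟩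
    · exact ⟨-1 + k, Or.inl (by
        rw [← Flag.act_adj, h.adj_one_two, ← Flag.act_mul, zpow_add, zpow_neg_one])⟩

theorem IsRotationPair.exists_mem_gen (h : IsRotationPair Φ s₁ s₂) (Ψ : Flag P) :
    ∃ g ∈ gen s₁ s₂, Ψ = Φ.act g ∨ Ψ = (Φ.adj 1).act g := by
  have m1 : s₁ ∈ gen s₁ s₂ := Subgroup.subset_closure (by simp)
  have m2 : s₂ ∈ gen s₁ s₂ := Subgroup.subset_closure (by simp)
  refine Flag.induction (fun Ψ : Flag P => ∃ g ∈ gen s₁ s₂, Ψ = Φ.act g ∨ Ψ = (Φ.adj 1).act g)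
    ?_ ⟨1, one_mem _, Or.inl rfl⟩ Ψ
  rintro i _ ⟨g, hg, rfl | rfl⟩ <;> rw [← Flag.act_adj] <;>
    obtain rfl | rfl | rfl := fin_three_eq i
  · exact ⟨s₁⁻¹ * g, mul_mem (inv_mem m1) hg, Or.inr (by rw [h.adj_zero, Flag.act_mul])⟩
  · exact ⟨g, hg, Or.inr rfl⟩
  · exact ⟨s₂ * g, mul_mem m2 hg, Or.inr (by rw [h.adj_two, Flag.act_mul])⟩
  · exact ⟨s₁ * g, mul_mem m1 hg, Or.inl (by rw [h.adj_one_zero, Flag.act_mul])⟩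
  · exact ⟨g, hg, Or.inl (by rw [Flag.adj_adj])⟩
  · exact ⟨s₂⁻¹ * g, mul_mem (inv_mem m2) hg, Or.inl (by rw [h.adj_one_two, Flag.act_mul])⟩

theorem IsChiral.exists_act_eq (hP : IsChiral P) (Φ : Flag P) (i j : Fin 3) :
    ∃ g : Aut P, Φ.act g = (Φ.adj i).adj j := by
  obtain ⟨C, -, -, horb, hadj⟩ := hP
  obtain ⟨g, hg⟩ := (horb Φ ((Φ.adj i).adj j)).2 (by
    have h1 := hadj i _ _ (Φ.isAdj_adj i)
    have h2 := hadj j _ _ ((Φ.adj i).isAdj_adj j)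
    tauto)
  exact ⟨g, sends_iff.1 hg⟩

theorem IsChiral.act_ne_adj (hP : IsChiral P) (Φ : Flag P) (i : Fin 3) (g : Aut P) :
    Φ.act g ≠ Φ.adj i := by
  obtain ⟨C, -, -, horb, hadj⟩ := hP
  intro h
  have h1 := (horb Φ (Φ.adj i)).1 ⟨g, sends_iff.2 h⟩
  have h2 := hadj i _ _ (Φ.isAdj_adj i)
  tauto

theorem IsChiral.act_ne_adj_act (hP : IsChiral P) (Φ : Flag P) (i : Fin 3) (g h : Aut P) :
    Φ.act g ≠ (Φ.adj i).act h := by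
  intro hgh
  apply hP.act_ne_adj Φ i (g * h⁻¹)
  rw [Flag.act_mul, hgh, ← Flag.act_mul, mul_inv_cancel, Flag.act_one]

theorem IsChiral.exists_isRotationPair (hP : IsChiral P) (Φ : Flag P) :
    ∃ s₁ s₂ : Aut P, IsRotationPair Φ s₁ s₂ := by
  obtain ⟨s₁, h1⟩ := hP.exists_act_eq Φ 1 0
  obtain ⟨s₂, h2⟩ := hP.exists_act_eq Φ 2 1
  exact ⟨s₁, s₂, isRotationPair_iff.2 ⟨h1, h2⟩⟩

theorem IsChiral.gen_eq_top (hP : IsChiral P) (h : IsRotationPair Φ s₁ s₂) :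
    gen s₁ s₂ = ⊤ := by
  rw [eq_top_iff]
  intro g _
  obtain ⟨g', hg', h1 | h1⟩ := h.exists_mem_gen (Φ.act g)
  · rwa [Φ.act_injective h1]
  · exact absurd h1 (hP.act_ne_adj_act Φ 1 g g')

theorem IsChiral.act_bijective (hP : IsChiral P) (h : IsRotationPair Φ s₁ s₂) :
    Function.Bijective fun a : Aut P × Bool =>
      if a.2 then Φ.act a.1 else (Φ.adj 1).act a.1 := by
  constructor
  · rintro ⟨g, _ | _⟩ ⟨g', _ | _⟩ hgg' <;> simp only [Bool.false_eq_true, if_true, if_false] at hgg'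
    · rw [Flag.act_injective _ hgg']
    · exact absurd hgg'.symm (hP.act_ne_adj_act Φ 1 _ _)
    · exact absurd hgg' (hP.act_ne_adj_act Φ 1 _ _)
    · rw [Flag.act_injective _ hgg']
  · intro Ψ
    obtain ⟨g, -, h1 | h1⟩ := h.exists_mem_gen Ψ
    · exact ⟨(g, true), h1.symm⟩
    · exact ⟨(g, false), h1.symm⟩

theorem encard_eq_card_of_bijective {α β : Type*} {S : Set β} {n : ℕ} (hS : S.encard = n)
    (f : α → S) (hf : Function.Bijective f) : Nat.card α = n := by
  rw [Nat.card_eq_of_bijective f hf, Nat.card_coe_set_eq, Set.ncard, hS, ENat.toNat_natCast]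

theorem zpow_apply_elt {s : Aut P} {x : P} (h : s.unop x = x) {g : Aut P}
    (hg : g ∈ Subgroup.zpowers s) : g.unop x = x := by
  have : Subgroup.zpowers s ≤ (MulAction.stabilizer (P ≃o P) x).op := by
    rw [Subgroup.zpowers_le]
    exact h
  exact this hg

theorem IsRotationPair.fixes_face (h : IsRotationPair Φ s₁ s₂) : s₁.unop (Φ.elt 2) = Φ.elt 2 := by
  have h1 := congrArg (fun Ω : Flag P => Ω.elt 2) (isRotationPair_iff.1 h).1
  simp only [Flag.adj_elt _ (show (2 : Fin 3) ≠ 0 by decide),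
    Flag.adj_elt _ (show (2 : Fin 3) ≠ 1 by decide)] at h1
  exact h1

theorem IsRotationPair.fixes_vertex (h : IsRotationPair Φ s₁ s₂) :
    s₂.unop (Φ.elt 0) = Φ.elt 0 := by
  have h1 := congrArg (fun Ω : Flag P => Ω.elt 0) (isRotationPair_iff.1 h).2
  simp only [Flag.adj_elt _ (show (0 : Fin 3) ≠ 1 by decide),
    Flag.adj_elt _ (show (0 : Fin 3) ≠ 2 by decide)] at h1
  exact h1

/-- ⟨s₁⟩ acts simply transitively on the edges of the base face: two translates of Φ with the same
edge and face could differ only by a 0-adjacency, which chirality forbids. -/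
theorem IsChiral.orderOf_left (hP : IsChiral P) (h : IsRotationPair Φ s₁ s₂) {p q : ℕ}
    (hT : HasType P p q) : orderOf s₁ = p := by
  have fix : ∀ g ∈ Subgroup.zpowers s₁, g.unop (Φ.elt 2) = Φ.elt 2 := fun g hg =>
    zpow_apply_elt h.fixes_face hg
  rw [← Nat.card_zpowers]
  refine encard_eq_card_of_bijective (hT.1 _ (Φ.rank_elt 2)) (fun g : Subgroup.zpowers s₁ =>
    ⟨(Φ.act g.1).elt 1, Flag.rank_elt _ _, ?_⟩) ⟨?_, ?_⟩
  · have h1 := (Φ.act g.1).edge_le_face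
    rwa [show (Φ.act g.1).elt 2 = Φ.elt 2 from fix g.1 g.2] at h1
  · rintro ⟨g, hg⟩ ⟨g', hg'⟩ hgg'
    have h1 : (Φ.act g).elt 1 = (Φ.act g').elt 1 := congrArg Subtype.val hgg'
    have h2 : (Φ.act g).elt 2 = (Φ.act g').elt 2 := (fix g hg).trans (fix g' hg').symm
    rcases Flag.eq_or_eq_adj (i := 0) (Φ := Φ.act g) (Ψ := Φ.act g') (by
      intro j hj
      obtain rfl | rfl | rfl := fin_three_eq j
      exacts [absurd rfl hj, h1, h2]) with h3 | h3
    · exact Subtype.ext (Φ.act_injective h3.symm)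
    · rw [← Flag.act_adj] at h3
      exact absurd h3 (hP.act_ne_adj_act Φ 0 _ _)
  · rintro ⟨e, he, hef⟩
    obtain ⟨Ψ, h1, h2⟩ := exists_flag_of_le hef
    rw [he] at h1
    rw [Φ.rank_elt] at h2
    obtain ⟨k, rfl | rfl⟩ := h.exists_of_elt_two h2
    · exact ⟨⟨s₁ ^ k, k, rfl⟩, Subtype.ext h1⟩
    · refine ⟨⟨s₁ ^ (1 + k), _, rfl⟩, Subtype.ext ?_⟩
      have e1 : Φ.adj 1 = (Φ.adj 0).act s₁ := by
        rw [h.adj_zero, ← Flag.act_mul, inv_mul_cancel, Flag.act_one]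
      rw [e1, ← Flag.act_mul, ← zpow_one_add, Flag.act_adj, Flag.adj_elt _ (by decide)] at h1
      exact h1

theorem IsChiral.orderOf_right (hP : IsChiral P) (h : IsRotationPair Φ s₁ s₂) {p q : ℕ}
    (hT : HasType P p q) : orderOf s₂ = q := by
  have fix : ∀ g ∈ Subgroup.zpowers s₂, g.unop (Φ.elt 0) = Φ.elt 0 := fun g hg =>
    zpow_apply_elt h.fixes_vertex hg
  rw [← Nat.card_zpowers]
  refine encard_eq_card_of_bijective (hT.2 _ (Φ.rank_elt 0)) (fun g : Subgroup.zpowers s₂ =>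
    ⟨(Φ.act g.1).elt 1, Flag.rank_elt _ _, ?_⟩) ⟨?_, ?_⟩
  · have h1 := (Φ.act g.1).vertex_le_edge
    rwa [show (Φ.act g.1).elt 0 = Φ.elt 0 from fix g.1 g.2] at h1
  · rintro ⟨g, hg⟩ ⟨g', hg'⟩ hgg'
    have h1 : (Φ.act g).elt 1 = (Φ.act g').elt 1 := congrArg Subtype.val hgg'
    have h0 : (Φ.act g).elt 0 = (Φ.act g').elt 0 := (fix g hg).trans (fix g' hg').symm
    rcases Flag.eq_or_eq_adj (i := 2) (Φ := Φ.act g) (Ψ := Φ.act g') (by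
      intro j hj
      obtain rfl | rfl | rfl := fin_three_eq j
      exacts [h0, h1, absurd rfl hj]) with h3 | h3
    · exact Subtype.ext (Φ.act_injective h3.symm)
    · rw [← Flag.act_adj] at h3
      exact absurd h3 (hP.act_ne_adj_act Φ 2 _ _)
  · rintro ⟨e, he, hve⟩
    obtain ⟨Ψ, h2, h1⟩ := exists_flag_of_le hve
    rw [he] at h1
    rw [Φ.rank_elt] at h2
    obtain ⟨k, rfl | rfl⟩ := h.exists_of_elt_zero h2
    · exact ⟨⟨s₂ ^ k, k, rfl⟩, Subtype.ext h1⟩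
    · refine ⟨⟨s₂ ^ (-1 + k), _, rfl⟩, Subtype.ext ?_⟩
      have e1 : Φ.adj 1 = (Φ.adj 2).act s₂⁻¹ := by
        rw [h.adj_two, ← Flag.act_mul, mul_inv_cancel, Flag.act_one]
      rw [e1, ← Flag.act_mul, ← zpow_neg_one, ← zpow_add, Flag.act_adj,
        Flag.adj_elt _ (by decide)] at h1
      exact h1

theorem IsChiral.tightPair (hP : IsChiral P) (h : IsRotationPair Φ s₁ s₂) {p q : ℕ}
    (hT : IsTightOfType P p q) : TightPair s₁ s₂ p q where
  gen_eq_top := hP.gen_eq_top h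
  orderOf_left := hP.orderOf_left h hT.1
  orderOf_right := hP.orderOf_right h hT.1
  sq_eq_one := h.mul_sq
  disjoint := by
    rw [Subgroup.disjoint_def]
    intro g hg1 hg2
    have e2 := zpow_apply_elt h.fixes_face hg1
    have e0 := zpow_apply_elt h.fixes_vertex hg2
    -- g fixes the base vertex and the base face, so it sends Φ to Φ or to Φ^1; chirality excludes
    -- the latter.
    rcases Flag.eq_or_eq_adj (i := 1) (Φ := Φ) (Ψ := Φ.act g) (by
      intro j hj
      obtain rfl | rfl | rfl := fin_three_eq j
      exacts [e0.symm, absurd rfl hj, e2.symm]) with h3 | h3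
    · exact Φ.act_injective (h3.trans Φ.act_one.symm)
    · exact absurd h3 (hP.act_ne_adj Φ 1 _)
  card_eq := by
    have h1 := Nat.card_eq_of_bijective _ (hP.act_bijective h)
    have h2 : Nat.card (Flag P) = 2 * p * q := by
      rw [show Nat.card (Flag P) = (ENat.card (Flag P)).toNat from rfl, hT.2, ENat.toNat_natCast]
    rw [Nat.card_prod, h2, Nat.card_eq_fintype_card (α := Bool), Fintype.card_bool] at h1
    linarith

/-- An inverting endomorphism τ would give the flag permutation exchanging Φ·g and Φ^1·τ(g). It
respects adjacency, hence comes from an automorphism, and this sends Φ to Φ^1. -/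
theorem IsChiral.not_reflexible (hP : IsChiral P) (h : IsRotationPair Φ s₁ s₂) :
    ¬ Reflexible s₁ s₂ := by
  rintro ⟨τ, h1, h2⟩
  have hττ : ∀ g, τ (τ g) = g := by
    have : (τ.comp τ) = MonoidHom.id _ := by
      apply MonoidHom.eq_of_eqOn_dense (hP.gen_eq_top h)
      rintro _ (rfl | rfl) <;> simp [h1, h2]
    exact fun g => DFunLike.congr_fun this g
  let E := Equiv.ofBijective _ (hP.act_bijective h)
  have Et : ∀ g, E (g, true) = Φ.act g := fun _ => rfl
  have Ef : ∀ g, E (g, false) = (Φ.adj 1).act g := fun _ => rfl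
  let ι : Equiv.Perm (Aut P × Bool) := Function.Involutive.toPerm (fun a => (τ a.1, !a.2))
    fun a => by simp [hττ]
  have hι : ∀ g b, ι (g, b) = (τ g, !b) := fun _ _ => rfl
  let θ : Equiv.Perm (Flag P) := (E.symm.trans ι).trans E
  have hθ : ∀ a, θ (E a) = E (ι a) := fun a => by simp [θ]
  have θt : ∀ g, θ (Φ.act g) = (Φ.adj 1).act (τ g) := fun g => hθ (g, true)
  have θf : ∀ g, θ ((Φ.adj 1).act g) = Φ.act (τ g) := fun g => hθ (g, false)
  obtain ⟨g, hg⟩ := exists_aut_of_flag_perm θ (by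
    intro i Ψ
    obtain ⟨g, -, rfl | rfl⟩ := h.exists_mem_gen Ψ <;> rw [← Flag.act_adj] <;>
      obtain rfl | rfl | rfl := fin_three_eq i
    · rw [h.adj_zero, ← Flag.act_mul, θf, θt, ← Flag.act_adj, h.adj_one_zero, ← Flag.act_mul,
        map_mul, map_inv, h1, inv_inv]
    · rw [θf, θt, ← Flag.act_adj, Flag.adj_adj]
    · rw [h.adj_two, ← Flag.act_mul, θf, θt, ← Flag.act_adj, h.adj_one_two, ← Flag.act_mul,
        map_mul, h2]
    · rw [h.adj_one_zero, ← Flag.act_mul, θt, θf, ← Flag.act_adj, h.adj_zero, ← Flag.act_mul,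
        map_mul, h1]
    · rw [Flag.adj_adj, θt, θf, ← Flag.act_adj]
    · rw [h.adj_one_two, ← Flag.act_mul, θt, θf, ← Flag.act_adj, h.adj_two, ← Flag.act_mul,
        map_mul, map_inv, h2, inv_inv])
  apply hP.act_ne_adj Φ 1 g
  rw [hg, ← Flag.act_one Φ, θt, map_one]
  rfl

end Rotation

/-! ### Coset polyhedra -/

section Coset

universe u

variable {H : Type u} [Group H]

/-- The conditions on two generators of a group under which the cosets of `⟨b⟩`, `⟨ab⟩` and `⟨a⟩`
form a polyhedron. -/
class PolyhedralPair (a b : H) : Prop where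
  gen_eq_top : gen a b = ⊤
  sq_eq_one : (a * b) ^ 2 = 1
  disjoint : Disjoint (Subgroup.zpowers a) (Subgroup.zpowers b)
  left_ne_one : a ≠ 1
  right_ne_one : b ≠ 1

/-- The stabilizers of the vertex, the edge and the face of the base flag. -/
def cosetSubgroup (a b : H) : Fin 3 → Subgroup H :=
  ![Subgroup.zpowers b, Subgroup.zpowers (a * b), Subgroup.zpowers a]

/-- The elements of the coset geometry: the cosets of the three stabilizers. -/
def CosetGeometry (a b : H) : Type u := Σ i : Fin 3, H ⧸ cosetSubgroup a b i

namespace CosetGeometry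

variable {a b : H}

/-- The coset of `k` of rank `i`. -/
def el (a b : H) (i : Fin 3) (k : H) : CosetGeometry a b := ⟨i, (k : H ⧸ cosetSubgroup a b i)⟩

theorem exists_eq_el (X : CosetGeometry a b) : ∃ k, X = el a b X.1 k := by
  obtain ⟨i, x⟩ := X
  obtain ⟨k, rfl⟩ := QuotientGroup.mk_surjective x
  exact ⟨k, rfl⟩

theorem el_eq_iff {i : Fin 3} {k l : H} :
    el a b i k = el a b i l ↔ k⁻¹ * l ∈ cosetSubgroup a b i := by
  rw [← QuotientGroup.eq]
  exact ⟨fun h => eq_of_heq (Sigma.mk.inj h).2, fun h => congrArg (Sigma.mk i) h⟩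

theorem el_zero_eq_iff {k l : H} :
    el a b 0 k = el a b 0 l ↔ k⁻¹ * l ∈ Subgroup.zpowers b := el_eq_iff

theorem el_two_eq_iff {k l : H} :
    el a b 2 k = el a b 2 l ↔ k⁻¹ * l ∈ Subgroup.zpowers a := el_eq_iff

theorem el_zero_mul (k : H) : el a b 0 (k * b) = el a b 0 k :=
  (el_zero_eq_iff.2 (by rw [inv_mul_cancel_left]; exact Subgroup.mem_zpowers b)).symm

theorem el_zero_mul_inv (k : H) : el a b 0 (k * b⁻¹) = el a b 0 k := by
  rw [← el_zero_mul, inv_mul_cancel_right]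

theorem el_two_mul (k : H) : el a b 2 (k * a) = el a b 2 k :=
  (el_two_eq_iff.2 (by rw [inv_mul_cancel_left]; exact Subgroup.mem_zpowers a)).symm

theorem el_two_mul_inv (k : H) : el a b 2 (k * a⁻¹) = el a b 2 k := by
  rw [← el_two_mul, inv_mul_cancel_right]

variable [hab : PolyhedralPair a b]

theorem aba (a b : H) [hab : PolyhedralPair a b] : a * b * a = b⁻¹ := by
  have h := hab.sq_eq_one
  rw [sq, ← mul_assoc] at h
  exact eq_inv_of_mul_eq_one_left h

theorem bab (a b : H) [hab : PolyhedralPair a b] : b * a * b = a⁻¹ := by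
  have h := hab.sq_eq_one
  rw [sq, mul_assoc, ← mul_assoc b] at h
  exact eq_inv_of_mul_eq_one_right h

theorem left_notMem (a b : H) [hab : PolyhedralPair a b] : a ∉ Subgroup.zpowers b := fun h =>
  hab.left_ne_one (Subgroup.disjoint_def.1 hab.disjoint (Subgroup.mem_zpowers a) h)

theorem right_notMem (a b : H) [hab : PolyhedralPair a b] : b ∉ Subgroup.zpowers a := fun h =>
  hab.right_ne_one (Subgroup.disjoint_def.1 hab.disjoint h (Subgroup.mem_zpowers b))

theorem el_one_eq_iff {k l : H} :
    el a b 1 k = el a b 1 l ↔ l = k ∨ l = k * a * b := by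
  rw [el_eq_iff]
  change k⁻¹ * l ∈ Subgroup.zpowers (a * b) ↔ _
  have h2 : (a * b) ^ (2 : ℤ) = 1 := by exact_mod_cast hab.sq_eq_one
  constructor
  · rintro ⟨n, hn⟩
    have hn : (a * b) ^ n = k⁻¹ * l := hn
    obtain ⟨m, rfl | rfl⟩ := n.even_or_odd'
    · left
      rw [zpow_mul, h2, one_zpow] at hn
      exact (inv_mul_eq_one.1 hn.symm).symm
    · right
      rw [zpow_add, zpow_mul, h2, one_zpow, one_mul, zpow_one] at hn
      rw [mul_assoc, hn, mul_inv_cancel_left]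
  · rintro (rfl | rfl)
    · rw [inv_mul_cancel]; exact one_mem _
    · rw [mul_assoc, inv_mul_cancel_left]; exact Subgroup.mem_zpowers _

theorem el_one_mul (k : H) : el a b 1 (k * a * b) = el a b 1 k :=
  (el_one_eq_iff.2 (Or.inr rfl)).symm

theorem el_one_mul_left (k : H) : el a b 1 (k * a⁻¹) = el a b 1 (k * b) := by
  rw [← bab a b, el_one_eq_iff.2 (Or.inr (show k * (b * a * b) = k * b * a * b by group))]

theorem el_two_mul_mul (k : H) : el a b 2 (k * a * b) = el a b 2 (k * b⁻¹) := by
  rw [← el_two_mul (k * a * b), ← aba a b]; simp only [mul_assoc]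

theorem el_zero_ne (k : H) : el a b 0 k ≠ el a b 0 (k * a) := by
  rw [Ne, el_zero_eq_iff, inv_mul_cancel_left]
  exact left_notMem a b

theorem el_two_ne (k : H) : el a b 2 k ≠ el a b 2 (k * b⁻¹) := by
  rw [Ne, el_two_eq_iff, inv_mul_cancel_left, inv_mem_iff]
  exact right_notMem a b

theorem el_one_ne (k : H) : el a b 1 k ≠ el a b 1 (k * b) := by
  rw [Ne, el_one_eq_iff, mul_assoc, mul_right_inj, mul_eq_left, right_eq_mul]
  exact not_or.2 ⟨hab.right_ne_one, hab.left_ne_one⟩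

theorem eq_of_el_eq {k l : H} (h0 : el a b 0 k = el a b 0 l) (h2 : el a b 2 k = el a b 2 l) :
    k = l :=
  inv_mul_eq_one.1 (Subgroup.disjoint_def.1 hab.disjoint (el_two_eq_iff.1 h2)
    (el_zero_eq_iff.1 h0))

/-- Incidence means having a common element. Transitivity through an edge uses that its coset is {k,
kab}: if the vertex contains k and the face contains kab, then both contain kb⁻¹. -/
instance : PartialOrder (CosetGeometry a b) where
  le X Y := X.1 ≤ Y.1 ∧ ∃ k, X = el a b X.1 k ∧ Y = el a b Y.1 k
  le_refl X := ⟨le_rfl, (exists_eq_el X).imp fun _ h => ⟨h, h⟩⟩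
  le_antisymm := by
    rintro X Y ⟨h1, k, hk, hk'⟩ ⟨h2, -⟩
    rw [hk, hk', le_antisymm h1 h2]
  le_trans := by
    rintro X Y Z ⟨h1, k, hX, hY⟩ ⟨h2, l, hY', hZ⟩
    refine ⟨h1.trans h2, ?_⟩
    obtain e | h1 := h1.eq_or_lt
    · exact ⟨l, by rw [e, ← hY', hX, e, ← hY], hZ⟩
    obtain e | h2 := h2.eq_or_lt
    · exact ⟨k, hX, by rw [← e, ← hY, hZ, ← e, ← hY']⟩
    have key : ∀ i j k : Fin 3, i < j → j < k → i = 0 ∧ j = 1 ∧ k = 2 := by decide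
    obtain ⟨e0, e1, e2⟩ := key _ _ _ h1 h2
    rw [e0] at hX ⊢
    rw [e1] at hY hY'
    rw [e2] at hZ ⊢
    obtain rfl | rfl := el_one_eq_iff.1 (hY.symm.trans hY')
    · exact ⟨l, hX, hZ⟩
    · exact ⟨k * b⁻¹, by rw [el_zero_mul_inv, hX], by rw [hZ, el_two_mul_mul]⟩

theorem el_le_el {i j : Fin 3} (h : i ≤ j) (k : H) : el a b i k ≤ el a b j k :=
  ⟨h, k, rfl, rfl⟩

theorem adj_iff {X Y : CosetGeometry a b} : (incidenceGraph (CosetGeometry a b)).Adj X Y ↔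
    X.1 ≠ Y.1 ∧ ∃ k, X = el a b X.1 k ∧ Y = el a b Y.1 k := by
  constructor
  · rintro ⟨hne, ⟨-, k, hX, hY⟩ | ⟨-, k, hY, hX⟩⟩
    all_goals exact ⟨fun h => hne (by rw [hX, hY, h]), k, hX, hY⟩
  · rintro ⟨hne, k, hX, hY⟩
    refine ⟨fun h => hne (by rw [h]), ?_⟩
    rcases le_total X.1 Y.1 with h | h
    exacts [Or.inl ⟨h, k, hX, hY⟩, Or.inr ⟨h, k, hY, hX⟩]

theorem el_adj_el {i j : Fin 3} (h : i ≠ j) (k : H) :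
    (incidenceGraph (CosetGeometry a b)).Adj (el a b i k) (el a b j k) :=
  adj_iff.2 ⟨h, k, rfl, rfl⟩

theorem setOf_vertices (k : H) :
    {v : CosetGeometry a b | v.1 = 0 ∧ v ≤ el a b 1 k} = {el a b 0 k, el a b 0 (k * a)} := by
  ext v
  constructor
  · rintro ⟨hv, -, l, h1, h2⟩
    rw [hv] at h1
    obtain rfl | rfl := el_one_eq_iff.1 h2
    · exact Or.inl h1
    · exact Or.inr (by rw [h1, el_zero_mul]; rfl)
  · rintro (rfl | rfl)
    · exact ⟨rfl, el_le_el (by decide) k⟩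
    · refine ⟨rfl, ?_⟩
      rw [← el_zero_mul, ← el_one_mul]
      exact el_le_el (by decide) _

theorem setOf_faces (k : H) :
    {f : CosetGeometry a b | f.1 = 2 ∧ el a b 1 k ≤ f} = {el a b 2 k, el a b 2 (k * b⁻¹)} := by
  ext f
  constructor
  · rintro ⟨hf, -, l, h1, h2⟩
    rw [hf] at h2
    obtain rfl | rfl := el_one_eq_iff.1 h1
    · exact Or.inl h2
    · exact Or.inr (by rw [h2, el_two_mul_mul]; rfl)
  · rintro (rfl | rfl)
    · exact ⟨rfl, el_le_el (by decide) k⟩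
    · refine ⟨rfl, ?_⟩
      rw [← el_two_mul_mul, ← el_one_mul]
      exact el_le_el (by decide) _

theorem setOf_edges (k : H) : {e : CosetGeometry a b | e.1 = 1 ∧ el a b 0 k ≤ e ∧ e ≤ el a b 2 k} =
    {el a b 1 k, el a b 1 (k * b)} := by
  ext e
  constructor
  · rintro ⟨he, ⟨-, l, h1, h2⟩, ⟨-, m, h3, h4⟩⟩
    rw [he] at h2 h3
    have h1 : el a b 0 k = el a b 0 l := h1
    have h4 : el a b 2 k = el a b 2 m := h4
    obtain rfl | rfl := el_one_eq_iff.1 (h2.symm.trans h3)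
    · exact Or.inl (by rw [h2, eq_of_el_eq h1 h4])
    · right
      rw [el_two_mul_mul] at h4
      rw [← el_zero_mul_inv l] at h1
      rw [eq_of_el_eq h1 h4, inv_mul_cancel_right]
      exact h2
  · rintro (rfl | rfl)
    · exact ⟨rfl, el_le_el (by decide) k, el_le_el (by decide) k⟩
    · refine ⟨rfl, ?_, ?_⟩
      · rw [← el_zero_mul]; exact el_le_el (by decide) _
      · rw [← el_two_mul_inv, ← el_one_mul_left]; exact el_le_el (by decide) _

theorem connected : (incidenceGraph (CosetGeometry a b)).Connected := by
  have step : ∀ k : H, (incidenceGraph (CosetGeometry a b)).Reachable (el a b 0 k)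
      (el a b 0 (k * a)) := fun k =>
    (el_adj_el (show (0 : Fin 3) ≠ 2 by decide) k).reachable.trans (by
      rw [← el_two_mul]
      exact (el_adj_el (show (2 : Fin 3) ≠ 0 by decide) (k * a)).reachable)
  have base : ∀ k : H, (incidenceGraph (CosetGeometry a b)).Reachable (el a b 0 1)
      (el a b 0 k) := by
    intro k
    have hk : k ∈ gen a b := by rw [hab.gen_eq_top]; trivial
    induction hk using Subgroup.closure_induction_right with
    | one => exact SimpleGraph.Reachable.refl _
    | mul_right k _ z hz ih =>
      obtain rfl | rfl := hz
      · exact ih.trans (step k)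
      · rwa [el_zero_mul]
    | mul_inv_cancel k _ z hz ih =>
      obtain rfl | rfl := hz
      · have h1 := step (k * z⁻¹)
        rw [inv_mul_cancel_right] at h1
        exact ih.trans h1.symm
      · rwa [el_zero_mul_inv]
  have all : ∀ X : CosetGeometry a b, (incidenceGraph (CosetGeometry a b)).Reachable
      (el a b 0 1) X := by
    intro X
    obtain ⟨k, hk⟩ := exists_eq_el X
    rw [hk]
    by_cases h : X.1 = 0
    · rw [h]; exact base k
    · exact (base k).trans (el_adj_el (Ne.symm h) k).reachable
  exact { preconnected := fun X Y => (all X).symm.trans (all Y), nonempty := ⟨el a b 0 1⟩ }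

/-- The link is traversed by alternating between the edges k c^n and the elements of rank j at k
c^(n+1), over all integers n. -/
theorem link_connected_aux {i j : Fin 3} (hi : i ≠ 1) (hj : j ≠ 1) (hij : i ≠ j) {c : H}
    (hc : cosetSubgroup a b i = Subgroup.zpowers c)
    (hadj : ∀ k, (incidenceGraph (CosetGeometry a b)).Adj (el a b 1 k) (el a b j (k * c))) (k : H) :
    ((incidenceGraph (CosetGeometry a b)).induce
      ((incidenceGraph (CosetGeometry a b)).neighborSet (el a b i k))).Connected := by
  set Γ := incidenceGraph (CosetGeometry a b)
  have hik : ∀ n : ℤ, el a b i k = el a b i (k * c ^ n) := by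
    intro n
    rw [el_eq_iff, inv_mul_cancel_left, hc]
    exact ⟨n, rfl⟩
  have mem : ∀ (l : Fin 3) (n : ℤ), i ≠ l → el a b l (k * c ^ n) ∈ Γ.neighborSet (el a b i k) := by
    intro l n hl
    rw [hik n]
    exact el_adj_el hl _
  have step : ∀ n : ℤ, (Γ.induce (Γ.neighborSet (el a b i k))).Reachable
      ⟨el a b 1 (k * c ^ n), mem 1 n hi⟩ ⟨el a b 1 (k * c ^ (n + 1)), mem 1 (n + 1) hi⟩ := by
    intro n
    have e1 : (Γ.induce (Γ.neighborSet (el a b i k))).Adj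
        ⟨el a b 1 (k * c ^ n), mem 1 n hi⟩ ⟨el a b j (k * c ^ (n + 1)), mem j (n + 1) hij⟩ := by
      have := hadj (k * c ^ n)
      rw [mul_assoc, ← zpow_add_one] at this
      exact this
    have e2 : (Γ.induce (Γ.neighborSet (el a b i k))).Adj
        ⟨el a b j (k * c ^ (n + 1)), mem j (n + 1) hij⟩
        ⟨el a b 1 (k * c ^ (n + 1)), mem 1 (n + 1) hi⟩ := el_adj_el hj _
    exact e1.reachable.trans e2.reachable
  have base : ∀ n : ℤ, (Γ.induce (Γ.neighborSet (el a b i k))).Reachable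
      ⟨el a b 1 (k * c ^ (0 : ℤ)), mem 1 0 hi⟩ ⟨el a b 1 (k * c ^ n), mem 1 n hi⟩ := by
    intro n
    induction n using Int.induction_on with
    | zero => exact SimpleGraph.Reachable.refl _
    | succ n ih => exact ih.trans (step n)
    | pred n ih =>
      have h1 := step (-n - 1)
      simp only [sub_add_cancel] at h1
      exact ih.trans h1.symm
  have all : ∀ Y : Γ.neighborSet (el a b i k), (Γ.induce (Γ.neighborSet (el a b i k))).Reachable
      ⟨el a b 1 (k * c ^ (0 : ℤ)), mem 1 0 hi⟩ Y := by
    rintro ⟨Y, hY⟩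
    obtain ⟨hne, l, hl, hYl⟩ := adj_iff.1 hY
    have hl : el a b i k = el a b i l := hl
    rw [el_eq_iff, hc] at hl
    obtain ⟨n, hn⟩ := hl
    have hln : l = k * c ^ n := by
      rw [show c ^ n = k⁻¹ * l from hn, mul_inv_cancel_left]
    subst hln
    have key : Y.1 = 1 ∨ Y.1 = j := by
      have : ∀ i j l : Fin 3, i ≠ 1 → j ≠ 1 → i ≠ j → i ≠ l → l = 1 ∨ l = j := by
        intro i j l; omega
      exact this i j Y.1 hi hj hij hne
    rcases key with h | h <;> rw [h] at hYl <;> subst hYl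
    · exact base n
    · refine (base n).trans (SimpleGraph.Adj.reachable ?_)
      exact el_adj_el (Ne.symm hj) _
  exact { preconnected := fun X Y => (all X).symm.trans (all Y), nonempty := ⟨_, mem 1 0 hi⟩ }

theorem link_connected (X : CosetGeometry a b) (hX : X.1 = 0 ∨ X.1 = 2) :
    ((incidenceGraph (CosetGeometry a b)).induce
      ((incidenceGraph (CosetGeometry a b)).neighborSet X)).Connected := by
  obtain ⟨k, hk⟩ := exists_eq_el X
  rw [hk]
  rcases hX with h | h <;> rw [h]
  · refine link_connected_aux (j := 2) (c := b⁻¹) (by decide) (by decide) (by decide) ?_ ?_ k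
    · exact (Subgroup.zpowers_inv (g := b)).symm
    · intro k
      rw [← el_two_mul_mul, ← el_one_mul]
      exact el_adj_el (by decide) _
  · refine link_connected_aux (j := 0) (c := a) (by decide) (by decide) (by decide) rfl ?_ k
    intro k
    rw [← el_zero_mul, ← el_one_mul]
    exact el_adj_el (by decide) _

instance : Polyhedron (CosetGeometry a b) where
  rank := Sigma.fst
  rank_strictMono := by
    rintro X Y ⟨⟨h, k, hX, hY⟩, h'⟩
    refine lt_of_le_of_ne h fun e => h' ?_
    rw [hX, hY, e]
    exact le_refl (el a b Y.1 k)
  edge_vertices := by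
    intro e he
    obtain ⟨k, hk⟩ := exists_eq_el e
    rw [hk, he, setOf_vertices, Set.ncard_pair (el_zero_ne k)]
  edge_faces := by
    intro e he
    obtain ⟨k, hk⟩ := exists_eq_el e
    rw [hk, he, setOf_faces, Set.ncard_pair (el_two_ne k)]
  diamond := by
    rintro v f hv hf ⟨-, k, hk, hk'⟩
    rw [hk, hk', hv, hf, setOf_edges, Set.ncard_pair (el_one_ne k)]
  connected := connected
  link_connected := link_connected

end CosetGeometry

/-! ### Flags, automorphisms, chirality and type of the coset polyhedron -/

namespace CosetGeometry

variable (a b : H)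

/-- Left translation of the cosets. -/
def translate (h : H) : CosetGeometry a b ≃ CosetGeometry a b :=
  Equiv.sigmaCongrRight fun i => MulAction.toPerm (β := H ⧸ cosetSubgroup a b i) h

theorem translate_el (h : H) (i : Fin 3) (k : H) :
    translate a b h (el a b i k) = el a b i (h * k) := rfl

theorem translate_symm (h : H) : (translate a b h).symm = translate a b h⁻¹ := by
  ext X
  obtain ⟨k, hk⟩ := exists_eq_el X
  rw [Equiv.symm_apply_eq, hk, translate_el, translate_el, mul_inv_cancel_left]

variable [hab : PolyhedralPair a b]

/-- The flag of the three cosets that contain `g`. -/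
def flag (g : H) : Flag (CosetGeometry a b) where
  elt i := el a b i g
  rank_elt _ := rfl
  vertex_le_edge := el_le_el (by decide) g
  edge_le_face := el_le_el (by decide) g

/-- The flag that is `1`-adjacent to `flag a b g`. -/
def coflag (g : H) : Flag (CosetGeometry a b) :=
  Flag.ofTriple (el a b 0 g) (el a b 1 (g * b)) (el a b 2 g) rfl rfl rfl
    (by rw [← el_zero_mul]; exact el_le_el (by decide) _)
    (by rw [← el_two_mul_inv, ← el_one_mul_left]; exact el_le_el (by decide) _)

theorem flag_adj_one (g : H) : (flag a b g).adj 1 = coflag a b g := by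
  refine (Flag.IsAdj.eq_adj ⟨el_one_ne g, fun j hj => ?_⟩).symm
  obtain rfl | rfl | rfl := fin_three_eq j
  exacts [rfl, absurd rfl hj, rfl]

theorem flag_adj_two (g : H) : (flag a b g).adj 2 = coflag a b (g * b⁻¹) := by
  refine (Flag.IsAdj.eq_adj ⟨el_two_ne g, fun j hj => ?_⟩).symm
  obtain rfl | rfl | rfl := fin_three_eq j
  · exact (el_zero_mul_inv g).symm
  · exact congrArg (el a b 1) (inv_mul_cancel_right g b).symm
  · exact absurd rfl hj

theorem flag_adj_zero (g : H) : (flag a b g).adj 0 = coflag a b (g * a) := by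
  refine (Flag.IsAdj.eq_adj ⟨el_zero_ne g, fun j hj => ?_⟩).symm
  obtain rfl | rfl | rfl := fin_three_eq j
  exacts [absurd rfl hj, (el_one_mul g).symm, (el_two_mul g).symm]

theorem coflag_adj_one (g : H) : (coflag a b g).adj 1 = flag a b g := by
  rw [← flag_adj_one, Flag.adj_adj]

theorem coflag_adj_two (g : H) : (coflag a b g).adj 2 = flag a b (g * b) := by
  rw [← (flag a b (g * b)).adj_adj 2, flag_adj_two, mul_inv_cancel_right]

theorem coflag_adj_zero (g : H) : (coflag a b g).adj 0 = flag a b (g * a⁻¹) := by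
  rw [← (flag a b (g * a⁻¹)).adj_adj 0, flag_adj_zero, inv_mul_cancel_right]

theorem flag_injective : Function.Injective (flag a b) := fun _ _ h =>
  eq_of_el_eq (congrArg (fun Φ : Flag (CosetGeometry a b) => Φ.elt 0) h)
    (congrArg (fun Φ : Flag (CosetGeometry a b) => Φ.elt 2) h)

theorem coflag_injective : Function.Injective (coflag a b) := fun _ _ h =>
  eq_of_el_eq (congrArg (fun Φ : Flag (CosetGeometry a b) => Φ.elt 0) h)
    (congrArg (fun Φ : Flag (CosetGeometry a b) => Φ.elt 2) h)

theorem flag_ne_coflag (g k : H) : flag a b g ≠ coflag a b k := by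
  intro h
  obtain rfl : g = k := eq_of_el_eq (congrArg (fun Φ : Flag (CosetGeometry a b) => Φ.elt 0) h)
    (congrArg (fun Φ : Flag (CosetGeometry a b) => Φ.elt 2) h)
  exact el_one_ne g (congrArg (fun Φ : Flag (CosetGeometry a b) => Φ.elt 1) h)

theorem translate_monotone (h : H) : Monotone (translate a b h) := by
  rintro X Y ⟨h1, k, hX, hY⟩
  refine ⟨h1, h * k, ?_, ?_⟩
  · exact (congrArg (translate a b h) hX).trans (translate_el a b h X.1 k)
  · exact (congrArg (translate a b h) hY).trans (translate_el a b h Y.1 k)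

/-- The homomorphism to the automorphism group given by left translations. -/
def toAut : H →* Aut (CosetGeometry a b) where
  -- The inverse makes left translation compatible with the left-to-right composition of
  -- automorphisms.
  toFun h := MulOpposite.op ((translate a b h⁻¹).toOrderIso (translate_monotone a b _)
    (by rw [translate_symm]; exact translate_monotone a b _))
  map_one' := by
    apply MulOpposite.unop_injective
    ext X
    obtain ⟨k, hk⟩ := exists_eq_el X
    change translate a b 1⁻¹ X = X
    rw [hk, translate_el, inv_one, one_mul]
  map_mul' g h := by
    apply MulOpposite.unop_injective
    ext X
    obtain ⟨k, hk⟩ := exists_eq_el X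
    change translate a b (g * h)⁻¹ X = translate a b h⁻¹ (translate a b g⁻¹ X)
    rw [hk, translate_el, translate_el, translate_el, mul_inv_rev, mul_assoc]

theorem flag_act (g h : H) : (flag a b g).act (toAut a b h) = flag a b (h⁻¹ * g) := rfl

theorem coflag_act (g h : H) : (coflag a b g).act (toAut a b h) = coflag a b (h⁻¹ * g) := by
  rw [← flag_adj_one, Flag.act_adj, flag_act, flag_adj_one]

theorem isRotationPair : IsRotationPair (flag a b 1) (toAut a b a) (toAut a b b) := by
  rw [isRotationPair_iff, flag_act, flag_act, flag_adj_one, coflag_adj_zero, flag_adj_two,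
    coflag_adj_one]
  simp

theorem exists_flag_eq (Ψ : Flag (CosetGeometry a b)) :
    ∃ g, Ψ = flag a b g ∨ Ψ = coflag a b g := by
  obtain ⟨s, hs, h⟩ := (isRotationPair a b).exists_mem_gen Ψ
  have hle : gen (toAut a b a) (toAut a b b) ≤ (toAut a b).range := by
    rw [Subgroup.closure_le]
    rintro _ (rfl | rfl)
    exacts [⟨a, rfl⟩, ⟨b, rfl⟩]
  obtain ⟨g, rfl⟩ := hle hs
  rw [flag_act, flag_adj_one, coflag_act] at h
  exact ⟨_, h⟩

theorem toAut_injective : Function.Injective (toAut a b) := by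
  intro g h hgh
  have h1 := congrArg (flag a b 1).act hgh
  rw [flag_act, flag_act] at h1
  simpa using flag_injective a b h1

/-- Conjugation by s inverts the translations by a and by b, so it preserves the group of
translations, which is a copy of H. -/
theorem reflexible_of_act_eq {s : Aut (CosetGeometry a b)}
    (hs : (flag a b 1).act s = coflag a b 1) : Reflexible a b := by
  obtain ⟨h1, h2⟩ := (isRotationPair a b).conj_eq_inv (hs.trans (flag_adj_one a b 1).symm)
  let c : H →* Aut (CosetGeometry a b) := (MulAut.conj s⁻¹).toMonoidHom.comp (toAut a b)
  have hc : ∀ h, c h = s⁻¹ * toAut a b h * s := fun h => by simp [c]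
  have ha : c a = toAut a b a⁻¹ := by rw [hc, h1, map_inv]
  have hb : c b = toAut a b b⁻¹ := by rw [hc, h2, map_inv]
  have hmem : ∀ h, c h ∈ (toAut a b).range := by
    have : gen a b ≤ (toAut a b).range.comap c := by
      rw [Subgroup.closure_le]
      rintro _ (rfl | rfl)
      exacts [⟨_, ha.symm⟩, ⟨_, hb.symm⟩]
    rw [hab.gen_eq_top] at this
    exact fun h => this (Subgroup.mem_top h)
  let e := MonoidHom.ofInjective (toAut_injective a b)
  refine ⟨e.symm.toMonoidHom.comp (c.codRestrict _ hmem), ?_, ?_⟩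
  · exact e.symm_apply_eq.2 (Subtype.ext ha)
  · exact e.symm_apply_eq.2 (Subtype.ext hb)

/-- Translations are transitive on the flags `flag g` and on the flags `coflag g`, and adjacency
exchanges the two kinds. An automorphism joining the kinds could be translated to one sending `flag
1` to `coflag 1`. -/
theorem isChiral (hr : ¬ Reflexible a b) : IsChiral (CosetGeometry a b) := by
  have hno : ∀ (g k : H) (s : Aut (CosetGeometry a b)), (flag a b g).act s ≠ coflag a b k := by
    intro g k s hs
    have e1 : flag a b g = (flag a b 1).act (toAut a b g⁻¹) := by rw [flag_act]; simp
    have e2 : coflag a b k = (coflag a b 1).act (toAut a b k⁻¹) := by rw [coflag_act]; simp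
    apply hr
    apply reflexible_of_act_eq a b (s := toAut a b g⁻¹ * s * (toAut a b k⁻¹)⁻¹)
    rw [Flag.act_mul, Flag.act_mul, ← e1, hs, ← Flag.eq_act_inv e2.symm]
  have hmem : ∀ g, flag a b g ∈ Set.range (flag a b) := fun g => ⟨g, rfl⟩
  have hnmem : ∀ g, coflag a b g ∉ Set.range (flag a b) := by
    rintro g ⟨k, hk⟩
    exact flag_ne_coflag a b k g hk
  refine ⟨Set.range (flag a b), ⟨_, hmem 1⟩, ⟨_, hnmem 1⟩, ?_, ?_⟩
  · intro Φ Ψ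
    simp only [sends_iff]
    obtain ⟨g, rfl | rfl⟩ := exists_flag_eq a b Φ <;> obtain ⟨k, rfl | rfl⟩ := exists_flag_eq a b Ψ
    · exact ⟨fun _ => by simp [hmem],
        fun _ => ⟨toAut a b (g * k⁻¹), by rw [flag_act]; simp⟩⟩
    · exact ⟨fun ⟨s, hs⟩ => absurd hs (hno g k s), fun h => absurd (h.1 (hmem g)) (hnmem k)⟩
    · exact ⟨fun ⟨s, hs⟩ => absurd (Flag.eq_act_inv hs).symm (hno k g s⁻¹),
        fun h => absurd (h.2 (hmem k)) (hnmem g)⟩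
    · exact ⟨fun _ => by simp only [hnmem],
        fun _ => ⟨toAut a b (g * k⁻¹), by rw [coflag_act]; simp⟩⟩
  · intro i Φ Ψ h
    rw [h.eq_adj]
    obtain ⟨g, rfl | rfl⟩ := exists_flag_eq a b Φ <;> obtain rfl | rfl | rfl := fin_three_eq i
    · simp only [flag_adj_zero, hmem, hnmem, not_false_eq_true]
    · simp only [flag_adj_one, hmem, hnmem, not_false_eq_true]
    · simp only [flag_adj_two, hmem, hnmem, not_false_eq_true]
    · simp only [coflag_adj_zero, hmem, hnmem, not_true_eq_false]
    · simp only [coflag_adj_one, hmem, hnmem, not_true_eq_false]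
    · simp only [coflag_adj_two, hmem, hnmem, not_true_eq_false]

theorem card_flag : Nat.card (Flag (CosetGeometry a b)) = 2 * Nat.card H := by
  have hbij : Function.Bijective (fun x : Bool × H => if x.1 then flag a b x.2 else coflag a b x.2) := by
    constructor
    · rintro ⟨_ | _, g⟩ ⟨_ | _, k⟩ h <;> simp only [Bool.false_eq_true, if_true, if_false] at h
      · rw [coflag_injective a b h]
      · exact absurd h.symm (flag_ne_coflag a b _ _)
      · exact absurd h (flag_ne_coflag a b _ _)
      · rw [flag_injective a b h]
    · intro Ψ
      obtain ⟨g, h | h⟩ := exists_flag_eq a b Ψ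
      exacts [⟨(true, g), h.symm⟩, ⟨(false, g), h.symm⟩]
  rw [← Nat.card_eq_of_bijective _ hbij, Nat.card_prod, Nat.card_eq_fintype_card (α := Bool),
    Fintype.card_bool]

theorem encard_zpowers [Finite H] (g c : H) (hc : ∀ k ∈ Subgroup.zpowers c, k ≠ a * b) :
    ((fun k => el a b 1 (g * k)) '' (Subgroup.zpowers c : Set H)).encard = orderOf c := by
  rw [Set.InjOn.encard_image, ← Set.Finite.cast_ncard_eq (Set.toFinite _), ← Nat.card_zpowers]
  · rfl
  · intro k hk l hl hkl
    rcases el_one_eq_iff.1 hkl with h | h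
    · exact (mul_left_cancel h).symm
    · exfalso
      apply hc (k⁻¹ * l) (mul_mem (inv_mem hk) hl)
      simp only [mul_assoc, mul_right_inj] at h
      rw [h, inv_mul_cancel_left]

theorem hasType [Finite H] : HasType (CosetGeometry a b) (orderOf a) (orderOf b) := by
  constructor
  · intro f hf
    obtain ⟨g, hg⟩ := exists_eq_el f
    have hf : f.1 = 2 := hf
    rw [hf] at hg
    subst hg
    rw [← encard_zpowers a b g a]
    · congr 1
      ext e
      constructor
      · rintro ⟨he, -, k, hk, hk'⟩
        have he : e.1 = 1 := he
        rw [he] at hk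
        exact ⟨g⁻¹ * k, el_two_eq_iff.1 hk', by simp only [hk, mul_inv_cancel_left]⟩
      · rintro ⟨k, hk, rfl⟩
        refine ⟨rfl, ?_⟩
        rw [(el_two_eq_iff (l := g * k)).2 (by rwa [inv_mul_cancel_left])]
        exact el_le_el (by decide) _
    · rintro k hk rfl
      exact right_notMem a b ((Subgroup.mul_mem_cancel_left _ (Subgroup.mem_zpowers a)).1 hk)
  · intro v hv
    obtain ⟨g, hg⟩ := exists_eq_el v
    have hv : v.1 = 0 := hv
    rw [hv] at hg
    subst hg
    rw [← encard_zpowers a b g b]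
    · congr 1
      ext e
      constructor
      · rintro ⟨he, -, k, hk, hk'⟩
        have he : e.1 = 1 := he
        rw [he] at hk'
        exact ⟨g⁻¹ * k, el_zero_eq_iff.1 hk, by simp only [hk', mul_inv_cancel_left]⟩
      · rintro ⟨k, hk, rfl⟩
        refine ⟨rfl, ?_⟩
        rw [(el_zero_eq_iff (l := g * k)).2 (by rwa [inv_mul_cancel_left])]
        exact el_le_el (by decide) _
    · rintro k hk rfl
      exact left_notMem a b ((Subgroup.mul_mem_cancel_right _ (Subgroup.mem_zpowers b)).1 hk)

end CosetGeometry

/-- A tight pair of generators without an inverting automorphism is realized by a tight chiral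
polyhedron. -/
theorem TightPair.exists_chiral {a b : H} {p q : ℕ} (h : TightPair a b p q) (hp : 0 < p)
    (hq : 0 < q) (hr : ¬ Reflexible a b) :
    ∃ (Q : Type u) (_ : Polyhedron Q), IsChiral Q ∧ IsTightOfType Q p q ∧
      ∃ (Ψ : Flag Q) (t₁ t₂ : Aut Q), IsRotationPair Ψ t₁ t₂ ∧
        ∃ f : H →* gen t₁ t₂, (f a : Aut Q) = t₁ ∧ (f b : Aut Q) = t₂ := by
  have : Finite H := Nat.finite_of_card_ne_zero (by rw [h.card_eq]; positivity)
  have hsq := h.sq_eq_one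
  have hab : PolyhedralPair a b :=
    { gen_eq_top := h.gen_eq_top
      sq_eq_one := hsq
      disjoint := h.disjoint
      left_ne_one := by
        rintro rfl
        -- If a = 1, then b² = 1 and the identity inverts both generators.
        refine hr ⟨MonoidHom.id H, by simp, ?_⟩
        rw [one_mul, sq] at hsq
        exact eq_inv_of_mul_eq_one_left hsq
      right_ne_one := by
        rintro rfl
        refine hr ⟨MonoidHom.id H, ?_, by simp⟩
        rw [mul_one, sq] at hsq
        exact eq_inv_of_mul_eq_one_left hsq }
  refine ⟨CosetGeometry a b, inferInstance, CosetGeometry.isChiral a b hr, ⟨?_, ?_⟩,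
    CosetGeometry.flag a b 1, _, _, CosetGeometry.isRotationPair a b,
    (CosetGeometry.toAut a b).codRestrict _ ?_, rfl, rfl⟩
  · have := CosetGeometry.hasType a b
    rwa [h.orderOf_left, h.orderOf_right] at this
  · have hcard := CosetGeometry.card_flag a b
    rw [h.card_eq, ← mul_assoc] at hcard
    have : Finite (Flag (CosetGeometry a b)) :=
      Nat.finite_of_card_ne_zero (by rw [hcard]; positivity)
    rw [ENat.card_eq_coe_natCard, hcard]
  · have : gen a b ≤ (gen (CosetGeometry.toAut a b a) (CosetGeometry.toAut a b b)).comap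
        (CosetGeometry.toAut a b) := by
      rw [Subgroup.closure_le]
      rintro _ (rfl | rfl)
      exacts [Subgroup.subset_closure (by simp), Subgroup.subset_closure (by simp)]
    rw [h.gen_eq_top] at this
    exact fun k => this (Subgroup.mem_top k)

end Coset

/-! ### From atomicity to reflexible quotients -/

section Atomic

universe u

variable {P : Type u} [Polyhedron P] {Φ : Flag P} {s₁ s₂ : Aut P}

/-- The form in which atomicity is contradicted: the coset polyhedron of a nonreflexible tight
quotient is chiral, and P covers it through the quotient map. -/
theorem exists_chiral_quotient (h : IsRotationPair Φ s₁ s₂) (N : Subgroup (Aut P))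
    [N.Normal] {p q : ℕ} (hT : TightPair (s₁ : Aut P ⧸ N) (s₂ : Aut P ⧸ N) p q) (hp : 0 < p)
    (hq : 0 < q) (hr : ¬ Reflexible (s₁ : Aut P ⧸ N) (s₂ : Aut P ⧸ N)) :
    ∃ (Q : Type u) (_ : Polyhedron Q), IsChiral Q ∧ IsTightOfType Q p q ∧ Covers P Q := by
  obtain ⟨Q, inst, hQ, hQT, Ψ, t₁, t₂, ht, f, h1, h2⟩ := hT.exists_chiral hp hq hr
  exact ⟨Q, inst, hQ, hQT, Φ, Ψ, s₁, s₂, t₁, t₂, h, ht,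
    (f.comp (QuotientGroup.mk' N)).comp (gen s₁ s₂).subtype, h1, h2⟩

end Atomic

end TightChiral

theorem mainTheorem6 {P : Type*} [TightChiral.Polyhedron P] (α β : ℕ) (hαβ : α < β)
    (hP : TightChiral.IsAtomicChiral P (2 ^ α) (2 ^ β)) (Φ : TightChiral.Flag P) :
    ∃ s₁ s₂ : TightChiral.Aut P, TightChiral.IsRotationPair Φ s₁ s₂ ∧
      ((α = 3 ∧ 5 ≤ β ∧
          (TightChiral.IsGP s₁ s₂ 8 (2 ^ β)
              3 (1 + 2 ^ (β - 2)) (-3) (-1 + 2 ^ (β - 2)) ∨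
            TightChiral.IsGP s₁ s₂ 8 (2 ^ β)
              3 (1 - 2 ^ (β - 2)) (-3) (-1 - 2 ^ (β - 2)))) ∨
        (β = α + 1 ∧ 4 ≤ α ∧
          (TightChiral.IsGP s₁ s₂ (2 ^ α) (2 ^ (α + 1))
              (-1 + 2 ^ (α - 1)) (-3 + 2 ^ (α - 1)) (1 + 2 ^ (α - 1)) (3 + 2 ^ (α - 1)) ∨
            TightChiral.IsGP s₁ s₂ (2 ^ α) (2 ^ (α + 1))
              (-1 + 2 ^ (α - 1)) (-3 - 2 ^ (α - 1)) (1 + 2 ^ (α - 1)) (3 - 2 ^ (α - 1))))) := by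
  obtain ⟨hchiral, htight, hatomic⟩ := hP
  obtain ⟨s₁, s₂, hs⟩ := hchiral.exists_isRotationPair Φ
  have hT := hchiral.tightPair hs htight
  refine ⟨s₁, s₂, hs, hT.classification hαβ (hchiral.not_reflexible hs) ?_ ?_⟩
  · intro hα N _ hN
    by_contra hr
    have e : 2 ^ α = 2 * 2 ^ (α - 1) := by rw [← pow_succ', Nat.sub_add_cancel hα]
    have hT' := TightChiral.TightPair.quotient (e ▸ hT) (by positivity) N hN
    obtain ⟨Q, inst, hQ, hQT, hcov⟩ := TightChiral.exists_chiral_quotient hs N hT'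
      (by positivity) (by positivity) hr
    exact (hatomic Q hQ hcov).1 _ (Nat.pow_lt_pow_right one_lt_two (by omega)) hQT
  · intro hβ N _ hN
    by_contra hr
    have e : 2 ^ β = 2 * 2 ^ (β - 1) := by rw [← pow_succ', Nat.sub_add_cancel hβ]
    -- The quotient lemma halves the order of the left generator, so the generators are exchanged
    -- before and after its use.
    have hT' := (TightChiral.TightPair.quotient (e ▸ hT.symm) (by positivity) N hN).symm
    obtain ⟨Q, inst, hQ, hQT, hcov⟩ := TightChiral.exists_chiral_quotient hs N hT'
      (by positivity) (by positivity) hr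
    exact (hatomic Q hQ hcov).2 _ (Nat.pow_lt_pow_right one_lt_two (by omega)) hQT
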